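/- **Conventions.** Let $n\ge 1$, $k,l\ge 0$ be integers. Let $\varphi\in C_c^\infty((0,\infty))$ be real-valued with $\sum_{j\in\mathbb Z}\varphi(2^{-j}\rho)=1$ for all $\rho>0$, and let $P_j=\varphi(2^{-j}D)$, $D=\sqrt{-\Delta}$, be the corresponding homogeneous Littlewood–Paley projections in $x\in\mathbb R^n$; thus $P_jf=K_j*f$, where $K_j$ is the inverse Fourier transform of the symbol $\varphi(2^{-j}|\xi|)$. For $0<T\le\infty$ and functions on $[0,T)\times\mathbb R^n$ put $$\|f\|_{L^p_tL^q_x}=\big\|\,\|f(t,\cdot)\|_{L^q(\mathbb R^n)}\big\|_{L^p([0,T))},\qquad \|f_j\|_{\ell^\lambda_{j}L^p_tL^q_x}=\big\|\,\|f_j\|_{L^p_tL^q_x}\big\|_{\ell^\lambda(j\in\mathbb Z)} .$$ A weight is a measurable, a.e. positive function $w$ on $\mathbb R^n$. For $1<p<\infty$ and $p'=p/(p-1)$, $w\in A_p$ means $\big(\int_Qw\,dx\big)\big(\int_Qw^{1-p'}dx\big)^{p-1}\le C|Q|^p$ for all cubes $Q$ with sides parallel to the axes; $w\in A_1$ means $\mathcal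 Mw\le Cw$ a.e., where $\mathcal Mw(x)=\sup_{r>0}r^{-n}\int_{B_r(x)}w\,dy$. A function $f$ on $\mathbb R^n$ is called tempered if $(1+|x|)^{-N}f\in L^1(\mathbb R^n)$ for some $N$. **Theorem (weighted fractional chain rule).** Let $s\in(0,1)$, $\lambda\in[1,\infty]$, $p,p_1,p_2\in[1,\infty]$ with $\frac1p=\frac1{p_1}+\frac1{p_2}$, and let $q\in(1,\infty)$. Let $\mu\in L^1([0,1])$ and let $w_1,w_2$ be (time-independent) weights on $\mathbb R^n$ with $(w_1w_2)^q\in A_q$. (a) Let $q_1,q_2\in(1,\infty)$ with $\frac1q=\frac1{q_1}+\frac1{q_2}$, and suppose $w_1^{q_1}\in A_{q_1}$ and $w_2^{q_2}\in A_{q_2}$. Then there is a constant $C$, depending only on $n,k,l,\varphi,s,\lambda,p,p_1,p_2,q,q_1,q_2,w_1,w_2,\mu$, such that $$\|w_1w_2\,2^{js}P_jF(u)\|_{\ell^\lambda_{j}L^p_tL^q_x}\le C\,\|w_1\,2^{js}P_ju\|_{\ell^\lambda_{j}L^{p_1}_tL^{q_1}_x}\,\|w_2\,G(u)\|_{L^{p_2}_tL^{q_2}_x}$$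 for all $F$, $G$, $T$, $u$ as described below. (b) (Endpoint $q_2=\infty$.) Suppose $w_1^{q}\in A_{q}$ and $w_2^{-1}\in A_1$. Then there is a constant $C$, depending only on $n,k,l,\varphi,s,\lambda,p,p_1,p_2,q,w_1,w_2,\mu$, such that $$\|w_1w_2\,2^{js}P_jF(u)\|_{\ell^\lambda_{j}L^p_tL^q_x}\le C\,\|w_1\,2^{js}P_ju\|_{\ell^\lambda_{j}L^{p_1}_tL^{q}_x}\,\|w_2\,G(u)\|_{L^{p_2}_tL^{\infty}_x}$$ for all $F$, $G$, $T$, $u$ as described below. Here $F:\mathbb R^k\to\mathbb R^l$ is any $C^1$ map with $F(0)=0$, and $G:\mathbb R^k\to(0,\infty)$ is any Borel measurable function, such that for all $v,w\in\mathbb R^k$ $$|F'(\tau v+(1-\tau)w)|\le\mu(\tau)\,|G(v)+G(w)|\qquad\text{for a.e. }\tau\in[0,1];$$ $T\in(0,\infty]$ is arbitrary; and $u:[0,T)\times\mathbb R^n\to\mathbb R^k$ is any measurable function such that, for a.e. $t$, the functions $u(t,\cdot)$ and $F(u(t,\cdot))$ are tempered and $u(t,\cdot)=\sum_{j\in\mathbb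 Z}P_ju(t,\cdot)$ in the sense of tempered distributions modulo constants, that is, $\sum_{|j|\le N}\int\psi\,P_ju(t,x)\,dx\to\int\psi\,u(t,x)\,dx$ as $N\to\infty$ for every Schwartz function $\psi$ with $\int\psi\,dx=0$. -/

import Mathlib

open MeasureTheory Set Filter Topology
open scoped ENNReal NNReal FourierTransform SchwartzMap ContDiff

noncomputable section

/-- A function `φ` on the half line that generates a homogeneous dyadic partition of unity:
smooth, compactly supported in `(0, ∞)`, with `∑_{j ∈ ℤ} φ (2^{-j} ρ) = 1` for every `ρ > 0`. -/
structure IsLittlewoodPaley (φ : ℝ → ℝ) : Prop where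
  smooth : ContDiff ℝ ∞ φ
  compact : HasCompactSupport φ
  support_pos : tsupport φ ⊆ Ioi 0
  partition : ∀ ρ : ℝ, 0 < ρ → HasSum (fun j : ℤ => φ ((2 : ℝ) ^ (-j) * ρ)) 1

/-- The symbol of `φ(2^{-j} D)`, `D = √(-Δ)`, in the frequency variable of Mathlib's Fourier
transform `∫ exp (-2 π i ⟨x, ξ⟩) f x dx`, for which `D` has the symbol `2 π |ξ|`. -/
def lpSymbol {n : ℕ} (φ : ℝ → ℝ) (j : ℤ) (ξ : EuclideanSpace ℝ (Fin n)) : ℝ :=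
  φ ((2 : ℝ) ^ (-j) * (2 * Real.pi * ‖ξ‖))

/-- The convolution kernel of `P_j`: the inverse Fourier transform of the symbol (it is
real, since the symbol is real and even; see `lpKernel_eq`). -/
def lpKernel {n : ℕ} (φ : ℝ → ℝ) (j : ℤ) (x : EuclideanSpace ℝ (Fin n)) : ℝ :=
  (𝓕⁻ (fun ξ : EuclideanSpace ℝ (Fin n) => ((lpSymbol φ j ξ : ℝ) : ℂ)) x).re

theorem lpKernel_eq {n : ℕ} (φ : ℝ → ℝ) (j : ℤ) (x : EuclideanSpace ℝ (Fin n)) :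
    ((lpKernel φ j x : ℝ) : ℂ) =
      𝓕⁻ (fun ξ : EuclideanSpace ℝ (Fin n) => ((lpSymbol φ j ξ : ℝ) : ℂ)) x := by
  unfold lpKernel
  rw [← Complex.conj_eq_iff_re, Real.fourierInv_eq', ← integral_conj,
    ← integral_neg_eq_self]
  refine integral_congr_ae (Eventually.of_forall fun ξ => ?_)
  have h2 : (starRingEnd ℂ) 2 = 2 := Complex.conj_ofNat 2
  simp [← Complex.exp_conj, lpSymbol, h2]

/-- The Littlewood-Paley projection `P_j f = φ(2^{-j} D) f = K_j * f`. -/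
def lpProj {n m : ℕ} (φ : ℝ → ℝ) (j : ℤ)
    (f : EuclideanSpace ℝ (Fin n) → EuclideanSpace ℝ (Fin m)) (x : EuclideanSpace ℝ (Fin n)) :
    EuclideanSpace ℝ (Fin m) :=
  ∫ y, lpKernel φ j (x - y) • f y

/-- Functions which are integrable against a polynomially decaying density; they are
tempered distributions, and `K * f` converges absolutely for every Schwartz function `K`. -/
def IsTemperedFun {n m : ℕ} (f : EuclideanSpace ℝ (Fin n) → EuclideanSpace ℝ (Fin m)) : Prop :=
  ∃ N : ℕ, Integrable (fun x => (1 + ‖x‖) ^ (-(N : ℝ)) • f x) volume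

/-- The homogeneous Littlewood-Paley decomposition `f = ∑_j P_j f` holds in the sense of
tempered distributions modulo constants, that is, when tested against Schwartz functions
of integral zero. -/
def HasLPDecomposition {n m : ℕ} (φ : ℝ → ℝ)
    (f : EuclideanSpace ℝ (Fin n) → EuclideanSpace ℝ (Fin m)) : Prop :=
  ∀ ψ : 𝓢(EuclideanSpace ℝ (Fin n), ℝ), ∫ x, ψ x = 0 →
    Tendsto
      (fun N : ℕ => ∫ x, ψ x • ∑ j ∈ Finset.Icc (-(N : ℤ)) (N : ℤ), lpProj φ j f x)
      atTop (𝓝 (∫ x, ψ x • f x))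

/-- A weight: a measurable function which is positive almost everywhere. -/
def IsWeight {n : ℕ} (w : EuclideanSpace ℝ (Fin n) → ℝ) : Prop :=
  AEMeasurable w volume ∧ ∀ᵐ x, 0 < w x

/-- The closed cube with lower corner `a` and side length `L`, sides parallel to the axes. -/
def cube {n : ℕ} (a : EuclideanSpace ℝ (Fin n)) (L : ℝ) : Set (EuclideanSpace ℝ (Fin n)) :=
  {x | ∀ i, a i ≤ x i ∧ x i ≤ a i + L}

/-- The Hardy-Littlewood maximal function `sup_{r > 0} r^{-n} ∫_{B_r(x)} w` of a nonnegative
function `w`. -/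
def maximalFn {n : ℕ} (w : EuclideanSpace ℝ (Fin n) → ℝ) (x : EuclideanSpace ℝ (Fin n)) : ℝ≥0∞ :=
  ⨆ (r : ℝ) (_ : 0 < r),
    ENNReal.ofReal (r ^ (-(n : ℝ))) * ∫⁻ y in Metric.ball x r, ENNReal.ofReal (w y)

/-- The Muckenhoupt class `A_1`. -/
def MuckenhouptOne {n : ℕ} (w : EuclideanSpace ℝ (Fin n) → ℝ) : Prop :=
  IsWeight w ∧ ∃ C : ℝ≥0, ∀ᵐ x, maximalFn w x ≤ C * ENNReal.ofReal (w x)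

/-- The Muckenhoupt class `A_p` for `1 < p < ∞`; here `p' = p / (p - 1)`. -/
def Muckenhoupt {n : ℕ} (p : ℝ) (w : EuclideanSpace ℝ (Fin n) → ℝ) : Prop :=
  IsWeight w ∧ ∃ C : ℝ≥0, ∀ (a : EuclideanSpace ℝ (Fin n)) (L : ℝ), 0 < L →
    (∫⁻ x in cube a L, ENNReal.ofReal (w x)) *
        (∫⁻ x in cube a L, ENNReal.ofReal (w x ^ (1 - Real.conjExponent p))) ^ (p - 1) ≤
      C * volume (cube a L) ^ p

/-- The time interval `[0, T)`, where `T = ∞` is allowed. -/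
def timeInterval (T : ℝ≥0∞) : Set ℝ := {t | 0 ≤ t ∧ ENNReal.ofReal t < T}

/-- The norm of `L^p_t L^q_x` on `[0, T) × ℝⁿ`. -/
def mixedNorm {n : ℕ} {E : Type*} [NormedAddCommGroup E] (p q : ℝ≥0∞) (T : ℝ≥0∞)
    (f : ℝ → EuclideanSpace ℝ (Fin n) → E) : ℝ≥0∞ :=
  eLpNorm (fun t => eLpNorm (f t) q volume) p (volume.restrict (timeInterval T))

/-- The norm `‖w 2^{js} P_j f‖` in `ℓ^r_{j ∈ ℤ} L^p_t L^q_x` on `[0, T) × ℝⁿ`. -/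
def besovNorm {n m : ℕ} (φ : ℝ → ℝ) (s : ℝ) (r p q : ℝ≥0∞) (T : ℝ≥0∞)
    (w : EuclideanSpace ℝ (Fin n) → ℝ)
    (f : ℝ → EuclideanSpace ℝ (Fin n) → EuclideanSpace ℝ (Fin m)) : ℝ≥0∞ :=
  eLpNorm
    (fun j : ℤ => mixedNorm p q T fun t x => (w x * (2 : ℝ) ^ ((j : ℝ) * s)) • lpProj φ j (f t) x)
    r Measure.count

/-- The hypotheses on the nonlinearity `F` and on the function `G` that dominates `F'`. -/
structure IsDominatedNonlinearity {k l : ℕ} (μ : ℝ → ℝ)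
    (F : EuclideanSpace ℝ (Fin k) → EuclideanSpace ℝ (Fin l))
    (G : EuclideanSpace ℝ (Fin k) → ℝ) : Prop where
  contDiff : ContDiff ℝ 1 F
  map_zero : F 0 = 0
  measurable_G : Measurable G
  pos_G : ∀ v, 0 < G v
  bound : ∀ v w, ∀ᵐ τ ∂(volume.restrict (Icc (0 : ℝ) 1)),
    ‖fderiv ℝ F (τ • v + (1 - τ) • w)‖ ≤ μ τ * |G v + G w|

/-- The functions `u` on `[0, T) × ℝⁿ` to which the estimate applies: measurable, and for almost
every time `u t` and `F ∘ u t` are tempered functions, so that `P_j (u t)` and `P_j (F (u t))` are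
defined, and `u t` is the sum of its Littlewood-Paley pieces modulo constants. -/
structure IsAdmissible {n k l : ℕ} (φ : ℝ → ℝ)
    (F : EuclideanSpace ℝ (Fin k) → EuclideanSpace ℝ (Fin l)) (T : ℝ≥0∞)
    (u : ℝ → EuclideanSpace ℝ (Fin n) → EuclideanSpace ℝ (Fin k)) : Prop where
  measurable : AEStronglyMeasurable (Function.uncurry u)
    ((volume.restrict (timeInterval T)).prod volume)
  tempered : ∀ᵐ t ∂(volume.restrict (timeInterval T)), IsTemperedFun (u t)
  tempered_comp : ∀ᵐ t ∂(volume.restrict (timeInterval T)), IsTemperedFun fun x => F (u t x)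
  decomposition : ∀ᵐ t ∂(volume.restrict (timeInterval T)), HasLPDecomposition φ (u t)

end

/-! `P_j` annihilates constants, so `P_j F(u)(x)` is the integral of `F(u(z)) - F(u(x))` against
`K_j(x - z)`. Integrating `F'` along a segment bounds that increment by a constant times `(G(u(x)) +
G(u(z))) |u(z) - u(x)|`, and the increment of `u` is split into the increments of the pieces `P_i
u`. For `i ≤ j` a reproducing kernel shows that `P_i u` varies only at scale `2^{-i}`
(`exists_enorm_lpProj_sub_le`), so that at distance `2^{-j}` a factor `2^{i-j}` is gained. For `i >
j` the triangle inequality is enough. Both cases are in `exists_lintegral_lpKernel_mul_le`.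

This leaves convolutions with `L^1`-normalized dyadic bumps, which are bounded on the weighted
spaces uniformly in the scale (`SmoothingBounded`). For `A_q` weights no maximal theorem is needed:
averages over balls of one fixed radius are handled by Hölder and Fubini
(`lintegral_ballAverage_le`), and a bump is a geometric series of such averages. At the endpoint,
`w₂⁻¹ ∈ A_1` says directly that averages preserve a bound by a multiple of `w₂⁻¹`.

Hölder in `x` gives the fixed-time estimate `WeightTriple.exists_eLpNorm_lpProj_comp_le` with
interaction factor `min 1 2^{i-j}`. Multiplied by `2^{js}` it becomes a convolution over `ℤ` with
kernel `2^{ms} min 1 2^{-m}`, which is summable precisely because `0 < s < 1`. Hölder and Minkowski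
in `t` and Young in `j` conclude.

The delicate point is that `u = ∑ P_i u` holds only modulo constants and in the weak sense. Only
increments of `u` matter, and when the sum of the norms with weights `min 1 2^i` is finite, the
increments of the pieces add up to a locally integrable function which agrees with `u` up to a
constant (`HasLPDecomposition.ae_enorm_sub_le`). When it is infinite, the right-hand side is
infinite, since `w₂ G(u)` has nonzero norm. -/

/-! ### Norm inequalities for functions with values in `ℝ≥0∞` -/

/-- Hölder's inequality for extended nonnegative functions. -/
theorem eLpNorm_ennreal_mul_le {α : Type*} [MeasurableSpace α] {μ : Measure α}
    {f g : α → ℝ≥0∞} (hf : AEMeasurable f μ) (hg : AEMeasurable g μ) {p p₁ p₂ : ℝ≥0∞}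
    (hp : 1 ≤ p) (hp₁ : 1 ≤ p₁) (hp₂ : 1 ≤ p₂) (hpp : 1 / p = 1 / p₁ + 1 / p₂) :
    eLpNorm (fun x => f x * g x) p μ ≤ eLpNorm f p₁ μ * eLpNorm g p₂ μ := by
  have p0 : p ≠ 0 := (zero_lt_one.trans_le hp).ne'
  have p₁0 : p₁ ≠ 0 := (zero_lt_one.trans_le hp₁).ne'
  have p₂0 : p₂ ≠ 0 := (zero_lt_one.trans_le hp₂).ne'
  -- An infinite exponent on one factor is treated apart; by symmetry this covers `p₁ = ⊤` and `p₂ =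
  -- ⊤`, and all exponents are finite afterwards.
  have aux : ∀ {f g : α → ℝ≥0∞} {p : ℝ≥0∞}, AEMeasurable g μ → p ≠ 0 →
      eLpNorm (fun x => f x * g x) p μ ≤ eLpNorm f ⊤ μ * eLpNorm g p μ := by
    intro f g p hg p0
    have hle : ∀ᵐ x ∂μ, f x ≤ eLpNorm f ⊤ μ := by
      simpa [eLpNorm_exponent_top, eLpNormEssSup] using ENNReal.ae_le_essSup f
    by_cases hpt : p = ⊤
    · subst hpt
      rw [eLpNorm_exponent_top, eLpNormEssSup]
      refine essSup_le_of_ae_le _ ?_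
      have hle' : ∀ᵐ x ∂μ, g x ≤ eLpNorm g ⊤ μ := by
        simpa [eLpNorm_exponent_top, eLpNormEssSup] using ENNReal.ae_le_essSup g
      filter_upwards [hle, hle'] with x h1 h2
      simpa using mul_le_mul' h1 h2
    · have hpr : 0 < p.toReal := ENNReal.toReal_pos p0 hpt
      rw [eLpNorm_eq_lintegral_rpow_enorm_toReal p0 hpt,
        eLpNorm_eq_lintegral_rpow_enorm_toReal p0 hpt]
      generalize eLpNorm f ⊤ μ = A at hle
      calc (∫⁻ x, ‖f x * g x‖ₑ ^ p.toReal ∂μ) ^ (1 / p.toReal)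
          ≤ (∫⁻ x, A ^ p.toReal * ‖g x‖ₑ ^ p.toReal ∂μ) ^ (1 / p.toReal) := by
            refine ENNReal.rpow_le_rpow (lintegral_mono_ae ?_) (by positivity)
            filter_upwards [hle] with x h1
            rw [← ENNReal.mul_rpow_of_nonneg _ _ hpr.le]
            exact ENNReal.rpow_le_rpow (by simpa using mul_le_mul_left h1 _) hpr.le
        _ = A * (∫⁻ x, ‖g x‖ₑ ^ p.toReal ∂μ) ^ (1 / p.toReal) := by
            rw [lintegral_const_mul'' _ (by simpa using hg.pow_const _),
              ENNReal.mul_rpow_of_nonneg _ _ (by positivity), ← ENNReal.rpow_mul,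
              mul_one_div_cancel hpr.ne', ENNReal.rpow_one]
  by_cases h1 : p₁ = ⊤
  · subst h1
    have : p = p₂ := by simpa using hpp
    subst this
    exact aux hg p0
  by_cases h2 : p₂ = ⊤
  · subst h2
    have : p = p₁ := by simpa using hpp
    subst this
    simpa [mul_comm] using aux (f := g) hf p0
  have hpt : p ≠ ⊤ := by
    rintro rfl
    have : p₁⁻¹ + p₂⁻¹ = 0 := by simpa using hpp.symm
    exact h1 (ENNReal.inv_eq_zero.1 (add_eq_zero.1 this).1)
  have hpr : 0 < p.toReal := ENNReal.toReal_pos p0 hpt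
  have hpr₁ : 0 < p₁.toReal := ENNReal.toReal_pos p₁0 h1
  have hpr₂ : 0 < p₂.toReal := ENNReal.toReal_pos p₂0 h2
  have hreal : 1 / p.toReal = 1 / p₁.toReal + 1 / p₂.toReal := by
    have := congrArg ENNReal.toReal hpp
    rw [ENNReal.toReal_add (by simpa using p₁0) (by simpa using p₂0)] at this
    simpa using this
  have hlt : p.toReal < p₁.toReal := by
    have : 1 / p₁.toReal < 1 / p.toReal := by
      rw [hreal]; have : 0 < 1 / p₂.toReal := by positivity
      linarith
    exact (one_div_lt_one_div hpr₁ hpr).1 this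
  rw [eLpNorm_eq_lintegral_rpow_enorm_toReal p0 hpt, eLpNorm_eq_lintegral_rpow_enorm_toReal p₁0 h1,
    eLpNorm_eq_lintegral_rpow_enorm_toReal p₂0 h2]
  simpa using ENNReal.lintegral_Lp_mul_le_Lq_mul_Lr hpr hlt hreal μ hf hg

/-- Minkowski's inequality for countable sums of extended nonnegative functions. -/
theorem eLpNorm_ennreal_tsum_le {α ι : Type*} [Countable ι] [MeasurableSpace α] {μ : Measure α}
    {f : ι → α → ℝ≥0∞} (hf : ∀ i, AEMeasurable (f i) μ) {p : ℝ≥0∞} (hp : 1 ≤ p) :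
    eLpNorm (fun x => ∑' i, f i x) p μ ≤ ∑' i, eLpNorm (f i) p μ := by
  have p0 : p ≠ 0 := (zero_lt_one.trans_le hp).ne'
  by_cases hpt : p = ⊤
  · subst hpt
    simp only [eLpNorm_exponent_top, eLpNormEssSup]
    refine essSup_le_of_ae_le _ ?_
    have : ∀ᵐ x ∂μ, ∀ i, f i x ≤ essSup (fun x => ‖f i x‖ₑ) μ := by
      rw [ae_all_iff]
      intro i
      simpa using ENNReal.ae_le_essSup (f i)
    filter_upwards [this] with x hx
    simpa using ENNReal.tsum_le_tsum hx
  have hpr : 0 < p.toReal := ENNReal.toReal_pos p0 hpt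
  have hfin : ∀ s : Finset ι, eLpNorm (fun x => ∑ i ∈ s, f i x) p μ ≤ ∑' i, eLpNorm (f i) p μ := by
    intro s
    refine le_trans ?_ (ENNReal.sum_le_tsum s)
    have := eLpNorm_sum_le (s := s) (f := f) (p := p) (μ := μ)
      (fun i _ => (hf i).aestronglyMeasurable) hp
    convert! this using 2
    ext x; simp
  simp only [eLpNorm_eq_lintegral_rpow_enorm_toReal p0 hpt, enorm_eq_self] at hfin ⊢
  generalize (∑' i, (∫⁻ x, f i x ^ p.toReal ∂μ) ^ (1 / p.toReal)) = A at hfin ⊢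
  rw [one_div, ENNReal.rpow_inv_le_iff hpr]
  have hfin' : ∀ s : Finset ι, ∫⁻ x, (∑ i ∈ s, f i x) ^ p.toReal ∂μ ≤ A ^ p.toReal := by
    intro s
    have := hfin s
    rwa [one_div, ENNReal.rpow_inv_le_iff hpr] at this
  -- Passage from finite to countable sums: the finite sums form a directed family, so monotone
  -- convergence applies.
  have : ∀ x, (∑' i, f i x) ^ p.toReal = ⨆ s : Finset ι, (∑ i ∈ s, f i x) ^ p.toReal := by
    intro x
    rw [ENNReal.tsum_eq_iSup_sum]
    exact (ENNReal.orderIsoRpow p.toReal hpr).map_iSup _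
  simp_rw [this]
  rw [lintegral_iSup_directed]
  · exact iSup_le hfin'
  · intro s
    exact (Finset.aemeasurable_fun_sum s fun i _ => hf i).pow_const _
  · intro s t
    classical
    refine ⟨s ∪ t, fun x => ?_, fun x => ?_⟩
    · exact ENNReal.rpow_le_rpow (Finset.sum_le_sum_of_subset Finset.subset_union_left) hpr.le
    · exact ENNReal.rpow_le_rpow (Finset.sum_le_sum_of_subset Finset.subset_union_right) hpr.le

/-- Regarding the constant as an `L^∞` factor in Hölder's inequality admits `c = ⊤` without a case
distinction. -/
theorem eLpNorm_ennreal_const_mul {α : Type*} [MeasurableSpace α] {μ : Measure α}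
    {f : α → ℝ≥0∞} (hf : AEMeasurable f μ) (c : ℝ≥0∞) {p : ℝ≥0∞} (hp : 1 ≤ p) :
    eLpNorm (fun x => c * f x) p μ ≤ c * eLpNorm f p μ := by
  refine (eLpNorm_ennreal_mul_le aemeasurable_const hf hp le_top hp (by simp)).trans ?_
  gcongr
  rw [eLpNorm_exponent_top, eLpNormEssSup]
  exact essSup_le_of_ae_le _ (Eventually.of_forall fun _ => by simp)

theorem eLpNorm_ennreal_add_le {α : Type*} [MeasurableSpace α] {μ : Measure α}
    {f g : α → ℝ≥0∞} (hf : AEMeasurable f μ) (hg : AEMeasurable g μ) {p : ℝ≥0∞} (hp : 1 ≤ p) :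
    eLpNorm (fun x => f x + g x) p μ ≤ eLpNorm f p μ + eLpNorm g p μ :=
  eLpNorm_add_le hf.aestronglyMeasurable hg.aestronglyMeasurable hp

theorem eLpNorm_ennreal_mono_ae {α : Type*} [MeasurableSpace α] {μ : Measure α}
    {f g : α → ℝ≥0∞} {p : ℝ≥0∞} (h : ∀ᵐ x ∂μ, f x ≤ g x) : eLpNorm f p μ ≤ eLpNorm g p μ :=
  eLpNorm_mono_enorm_ae (by simpa using h)

/-- Young's inequality `ℓ^1 * ℓ^r ⊆ ℓ^r` on `ℤ`. -/
theorem eLpNorm_int_convolution_le (κ a : ℤ → ℝ≥0∞) {r : ℝ≥0∞} (hr : 1 ≤ r) :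
    eLpNorm (fun j : ℤ => ∑' m : ℤ, κ m * a (j - m)) r Measure.count ≤
      (∑' m, κ m) * eLpNorm a r Measure.count := by
  refine (eLpNorm_ennreal_tsum_le (fun m => (measurable_of_countable _).aemeasurable) hr).trans ?_
  rw [← ENNReal.tsum_mul_right]
  refine ENNReal.tsum_le_tsum fun m => ?_
  refine (eLpNorm_ennreal_const_mul (measurable_of_countable _).aemeasurable _ hr).trans ?_
  gcongr
  have hmp : MeasurePreserving (fun j : ℤ => j - m) Measure.count Measure.count := by
    exact measurePreserving_sub_right _ m
  exact (eLpNorm_comp_measurePreserving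
    (measurable_of_countable a).aestronglyMeasurable hmp).le

/-- Measurability of partial `L^q` norms. -/
theorem Measurable.eLpNorm_prod_right {α β : Type*} [MeasurableSpace α] [MeasurableSpace β]
    {ν : Measure β} [SFinite ν] {f : α → β → ℝ≥0∞} (hf : Measurable (Function.uncurry f))
    (q : ℝ≥0∞) : Measurable fun t => eLpNorm (f t) q ν := by
  by_cases q0 : q = 0
  · simp [q0]
  by_cases hq : q = ⊤
  · subst hq
    refine measurable_of_Iic fun c => ?_
    -- An essential supremum is at most `c` iff the slice of the measurable set `{f > c}` is null,
    -- and the measure of slices is measurable.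
    have : (fun t => eLpNorm (f t) ⊤ ν) ⁻¹' Iic c =
        {t | ν (Prod.mk t ⁻¹' {z | c < Function.uncurry f z}) = 0} := by
      ext t
      simp only [mem_preimage, mem_Iic, mem_ofPred_eq, eLpNorm_exponent_top, eLpNormEssSup,
        enorm_eq_self]
      constructor
      · intro h
        have : ∀ᵐ x ∂ν, f t x ≤ c := (ENNReal.ae_le_essSup (f t)).mono fun x hx => hx.trans h
        rw [ae_iff] at this
        simpa [preimage] using this
      · intro h
        refine essSup_le_of_ae_le _ ?_
        rw [EventuallyLE, ae_iff]
        simpa [preimage] using h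
    rw [this]
    exact measurable_measure_prodMk_left (measurableSet_lt measurable_const hf)
      (measurableSet_singleton 0)
  · simp only [eLpNorm_eq_lintegral_rpow_enorm_toReal q0 hq, enorm_eq_self]
    exact (Measurable.lintegral_prod_right' (f := fun z : α × β => Function.uncurry f z ^ q.toReal)
      (hf.pow_const _)).pow_const _

/-! ### Ball averages on weighted spaces -/

theorem volume_cube {n : ℕ} (a : EuclideanSpace ℝ (Fin n)) (L : ℝ) :
    volume (cube a L) = ENNReal.ofReal L ^ n := by
  have h : cube a L = (MeasurableEquiv.toLp 2 (Fin n → ℝ)).symm ⁻¹'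
      (Set.Icc (fun i => a i) (fun i => a i + L)) := by
    ext x
    simp only [cube, mem_ofPred_eq, mem_preimage, mem_Icc, Pi.le_def, forall_and]
    rfl
  rw [h, (EuclideanSpace.volume_preserving_symm_measurableEquiv_toLp (Fin n)).measure_preimage
    measurableSet_Icc.nullMeasurableSet, Real.volume_Icc_pi]
  simp

theorem ball_subset_cube {n : ℕ} (y : EuclideanSpace ℝ (Fin n)) (ρ : ℝ) :
    Metric.ball y ρ ⊆ cube (y - WithLp.toLp 2 (fun _ => ρ)) (2 * ρ) := by
  intro x hx i
  have h1 : ‖(x - y) i‖ ≤ ‖x - y‖ := PiLp.norm_apply_le (x - y) i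
  rw [mem_ball_iff_norm] at hx
  simp only [PiLp.sub_apply, Real.norm_eq_abs] at h1 ⊢
  have := abs_le.1 (h1.trans hx.le)
  constructor <;> linarith

/-- The normalized average over the ball of radius `r`. -/
noncomputable def ballAverage {n : ℕ} (r : ℝ) (f : EuclideanSpace ℝ (Fin n) → ℝ≥0∞)
    (x : EuclideanSpace ℝ (Fin n)) : ℝ≥0∞ :=
  ENNReal.ofReal (r ^ (-(n : ℝ))) * ∫⁻ y in Metric.ball x r, f y

theorem lintegral_ball_eq {n : ℕ} (r : ℝ) (f : EuclideanSpace ℝ (Fin n) → ℝ≥0∞)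
    (x : EuclideanSpace ℝ (Fin n)) :
    ∫⁻ y in Metric.ball x r, f y =
      ∫⁻ y, {z : EuclideanSpace ℝ (Fin n) × EuclideanSpace ℝ (Fin n) |
        dist z.2 z.1 < r}.indicator (fun z => f z.2) (x, y) := by
  rw [← lintegral_indicator Metric.isOpen_ball.measurableSet]
  rfl

theorem measurable_lintegral_ball {n : ℕ} (r : ℝ) {f : EuclideanSpace ℝ (Fin n) → ℝ≥0∞}
    (hf : Measurable f) : Measurable fun x => ∫⁻ y in Metric.ball x r, f y := by
  simp_rw [lintegral_ball_eq]
  refine Measurable.lintegral_prod_right' ?_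
  refine (hf.comp measurable_snd).indicator ?_
  exact measurableSet_lt (measurable_snd.dist measurable_fst) measurable_const

theorem measurable_ballAverage {n : ℕ} (r : ℝ) {f : EuclideanSpace ℝ (Fin n) → ℝ≥0∞}
    (hf : Measurable f) : Measurable (ballAverage r f) :=
  (measurable_lintegral_ball r hf).const_mul _

/-- Hölder's inequality against a weight. -/
theorem lintegral_rpow_le_weighted {α : Type*} [MeasurableSpace α] {ν : Measure α} {q : ℝ}
    (hq : 1 < q) {W f : α → ℝ≥0∞} (hW : Measurable W) (hf : Measurable f)
    (hW0 : ∀ᵐ x ∂ν, W x ≠ 0) (hWt : ∀ᵐ x ∂ν, W x ≠ ⊤) :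
    (∫⁻ x, f x ∂ν) ^ q ≤ (∫⁻ x, (W x * f x) ^ q ∂ν) *
      (∫⁻ x, W x ^ (-Real.conjExponent q) ∂ν) ^ (q - 1) := by
  have hpq : q.HolderConjugate (Real.conjExponent q) := Real.HolderConjugate.conjExponent hq
  have h1 : ∫⁻ x, f x ∂ν = ∫⁻ x, ((fun x => W x * f x) * fun x => (W x)⁻¹) x ∂ν := by
    refine lintegral_congr_ae ?_
    filter_upwards [hW0, hWt] with x h0 ht
    simp only [Pi.mul_apply]
    rw [mul_comm (W x), mul_assoc, ENNReal.mul_inv_cancel h0 ht, mul_one]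
  rw [h1]
  refine (ENNReal.rpow_le_rpow (ENNReal.lintegral_mul_le_Lp_mul_Lq ν hpq
    (hW.mul hf).aemeasurable hW.inv.aemeasurable) (by linarith)).trans ?_
  have hq0 : 0 < q := by linarith
  rw [ENNReal.mul_rpow_of_nonneg _ _ hq0.le, ← ENNReal.rpow_mul, ← ENNReal.rpow_mul,
    one_div_mul_cancel hq0.ne', ENNReal.rpow_one]
  have h2 : 1 / Real.conjExponent q * q = q - 1 := by
    have : q - 1 ≠ 0 := by linarith
    simp only [Real.conjExponent]
    field_simp
  rw [h2]
  refine mul_le_mul' le_rfl (ENNReal.rpow_le_rpow (lintegral_mono fun x => ?_) (by linarith))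
  rw [Pi.inv_apply, ← ENNReal.rpow_neg_one, ← ENNReal.rpow_mul]
  simp

/-- Hölder against the weight on `B(x, r)` produces `∫ (W f)^q` times a power of the dual weight's
mass. For `y ∈ B(x, r)` that mass is at most its value over `B(y, 2r)`, which no longer depends on
`x`. Fubini then leaves `∫ W^q` over `B(y, r)`, and the `A_q` condition on one cube around `y`
controls the product. -/
theorem lintegral_ballAverage_le {n : ℕ} {q : ℝ} (hq : 1 < q)
    {W f : EuclideanSpace ℝ (Fin n) → ℝ≥0∞} (hW : Measurable W) (hf : Measurable f)
    (hW0 : ∀ᵐ x, W x ≠ 0) (hWt : ∀ᵐ x, W x ≠ ⊤) {C : ℝ≥0∞}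
    (hC : ∀ (a : EuclideanSpace ℝ (Fin n)) (L : ℝ), 0 < L →
      (∫⁻ x in cube a L, W x ^ q) *
        (∫⁻ x in cube a L, W x ^ (-Real.conjExponent q)) ^ (q - 1) ≤ C * volume (cube a L) ^ q)
    {r : ℝ} (hr : 0 < r) :
    ∫⁻ x, (W x * ballAverage r f x) ^ q ≤ C * (4 ^ n) ^ q * ∫⁻ x, (W x * f x) ^ q := by
  have hq0 : 0 < q := by linarith
  set σ : EuclideanSpace ℝ (Fin n) → ℝ≥0∞ := fun x => W x ^ (-Real.conjExponent q) with hσ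
  have hσm : Measurable σ := hW.pow_const _
  -- The radius `2r` is what makes this ball contain `B(x, r)` whenever `|x - y| < r`.
  set S : EuclideanSpace ℝ (Fin n) → ℝ≥0∞ := fun y => ∫⁻ z in Metric.ball y (2 * r), σ z with hS
  have hSm : Measurable S := measurable_lintegral_ball _ hσm
  set c : ℝ≥0∞ := ENNReal.ofReal (r ^ (-(n : ℝ))) with hc
  set D : Set (EuclideanSpace ℝ (Fin n) × EuclideanSpace ℝ (Fin n)) := {z | dist z.2 z.1 < r}
  have hD : MeasurableSet D :=
    measurableSet_lt (measurable_snd.dist measurable_fst) measurable_const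
  set K : EuclideanSpace ℝ (Fin n) → EuclideanSpace ℝ (Fin n) → ℝ≥0∞ := fun x y =>
    D.indicator (fun z => W z.1 ^ q * (S z.2 ^ (q - 1) * (W z.2 * f z.2) ^ q)) (x, y) with hK
  have hKm : Measurable (Function.uncurry K) := by
    refine Measurable.indicator ?_ hD
    fun_prop
  have step1 : ∀ x, (W x * ballAverage r f x) ^ q ≤ c ^ q * ∫⁻ y, K x y := by
    intro x
    simp only [ballAverage]
    rw [mul_left_comm, ENNReal.mul_rpow_of_nonneg _ _ hq0.le, ENNReal.mul_rpow_of_nonneg _ _ hq0.le]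
    refine mul_le_mul_right ?_ _
    refine (mul_le_mul_right (lintegral_rpow_le_weighted hq hW hf (ae_restrict_of_ae hW0)
      (ae_restrict_of_ae hWt)) _).trans ?_
    rw [mul_comm (lintegral _ _), ← mul_assoc, lintegral_ball_eq r (fun y => (W y * f y) ^ q)]
    refine (lintegral_const_mul_le _ _).trans ?_
    refine lintegral_mono fun y => ?_
    by_cases hxy : (x, y) ∈ D
    · simp only [hK, D] at hxy ⊢
      rw [indicator_of_mem hxy, indicator_of_mem hxy]
      simp only
      rw [mul_assoc]
      refine mul_le_mul' le_rfl (mul_le_mul' (ENNReal.rpow_le_rpow (lintegral_mono_set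
        (Metric.ball_subset_ball' ?_)) (by linarith)) le_rfl)
      have : dist y x < r := hxy
      rw [dist_comm] at this
      linarith
    · simp only [hK, D] at hxy ⊢
      rw [indicator_of_notMem hxy, indicator_of_notMem hxy]
      simp
  have step2 : ∀ y, ∫⁻ x, K x y ≤ C * volume (cube y (4 * r)) ^ q * (W y * f y) ^ q := by
    intro y
    have hle : ∀ x, K x y = (Metric.ball y r).indicator
        (fun x => W x ^ q * (S y ^ (q - 1) * (W y * f y) ^ q)) x := by
      intro x
      simp only [hK, D, indicator, mem_ofPred_eq, Metric.mem_ball, dist_comm y x]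
    simp_rw [hle]
    rw [lintegral_indicator Metric.isOpen_ball.measurableSet,
      lintegral_mul_const _ (hW.pow_const _), ← mul_assoc]
    refine mul_le_mul' ?_ le_rfl
    -- The cube of side `4r` centred at `y`; its volume `(4r)^n` against the normalization `r^{-n}`
    -- is the origin of `(4^n)^q`.
    have h4 := hC (y - WithLp.toLp 2 (fun _ => 2 * r)) (2 * (2 * r)) (by positivity)
    rw [volume_cube] at h4 ⊢
    rw [show 4 * r = 2 * (2 * r) by ring]
    refine le_trans (mul_le_mul' (lintegral_mono_set ?_) (ENNReal.rpow_le_rpow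
      (lintegral_mono_set (ball_subset_cube y (2 * r))) (by linarith))) h4
    exact (Metric.ball_subset_ball (by linarith)).trans (ball_subset_cube y (2 * r))
  calc ∫⁻ x, (W x * ballAverage r f x) ^ q ≤ ∫⁻ x, c ^ q * ∫⁻ y, K x y := lintegral_mono step1
    _ = c ^ q * ∫⁻ x, ∫⁻ y, K x y := lintegral_const_mul _ hKm.lintegral_prod_right'
    _ = c ^ q * ∫⁻ y, ∫⁻ x, K x y := by rw [lintegral_lintegral_swap hKm.aemeasurable]
    _ ≤ c ^ q * ∫⁻ y, C * (ENNReal.ofReal (4 * r) ^ n) ^ q * (W y * f y) ^ q := by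
        gcongr with y
        simpa only [volume_cube] using step2 y
    _ = C * (4 ^ n) ^ q * ∫⁻ x, (W x * f x) ^ q := by
        rw [lintegral_const_mul _ (by fun_prop), ← mul_assoc]
        congr 1
        rw [mul_left_comm, ← ENNReal.mul_rpow_of_nonneg _ _ hq0.le]
        congr 2
        rw [hc, ← ENNReal.ofReal_pow (by positivity), ← ENNReal.ofReal_mul (by positivity),
          mul_pow, Real.rpow_neg hr.le, Real.rpow_natCast, mul_left_comm,
          inv_mul_cancel₀ (by positivity), mul_one, ENNReal.ofReal_pow (by norm_num)]
        simp

theorem IsWeight.ofReal_ne {n : ℕ} {w : EuclideanSpace ℝ (Fin n) → ℝ} (hw : IsWeight w) :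
    ∀ᵐ x, ENNReal.ofReal (w x) ≠ 0 :=
  hw.2.mono fun x hx => by simpa using hx

/-- Averages over balls are bounded on `L^q` with an `A_q` weight, uniformly in the radius. -/
theorem eLpNorm_ballAverage_le {n : ℕ} {q : ℝ} (hq : 1 < q)
    {w : EuclideanSpace ℝ (Fin n) → ℝ} (hw : IsWeight w)
    (hA : Muckenhoupt q fun x => w x ^ q) :
    ∃ C : ℝ≥0, ∀ r : ℝ, 0 < r → ∀ f : EuclideanSpace ℝ (Fin n) → ℝ≥0∞, Measurable f →
      eLpNorm (fun x => ENNReal.ofReal (w x) * ballAverage r f x) (ENNReal.ofReal q) volume ≤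
        C * eLpNorm (fun x => ENNReal.ofReal (w x) * f x) (ENNReal.ofReal q) volume := by
  obtain ⟨-, C, hC⟩ := hA
  have hq0 : 0 < q := by linarith
  obtain ⟨w', hw', hww'⟩ := hw.1
  refine ⟨(C * (4 ^ n) ^ q) ^ (1 / q), fun r hr f hf => ?_⟩
  have e : ∀ g : EuclideanSpace ℝ (Fin n) → ℝ≥0∞,
      eLpNorm (fun x => ENNReal.ofReal (w x) * g x) (ENNReal.ofReal q) volume =
        (∫⁻ x, (ENNReal.ofReal (w' x) * g x) ^ q) ^ (1 / q) := by
    intro g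
    rw [eLpNorm_eq_lintegral_rpow_enorm_toReal (by simpa using hq0) ENNReal.ofReal_ne_top,
      ENNReal.toReal_ofReal hq0.le]
    congr 1
    refine lintegral_congr_ae ?_
    filter_upwards [hww'] with x hx
    simp [hx]
  have hpos : ∀ᵐ x, 0 < w' x := by
    filter_upwards [hww', hw.2] with x h1 h2
    rwa [← h1]
  rw [e, e]
  have key := lintegral_ballAverage_le hq (W := fun x => ENNReal.ofReal (w' x)) (C := C)
    (by fun_prop) hf (hpos.mono fun x hx => by simpa using hx) (by simp) ?_ hr
  · refine (ENNReal.rpow_le_rpow key (by positivity)).trans_eq ?_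
    rw [ENNReal.mul_rpow_of_nonneg _ _ (by positivity),
      ENNReal.coe_rpow_of_nonneg _ (by positivity), ENNReal.coe_mul,
      ENNReal.coe_rpow_of_nonneg _ hq0.le]
    simp
  · intro a L hL
    convert! hC a L hL using 2
    · refine lintegral_congr_ae (ae_restrict_of_ae ?_)
      filter_upwards [hww', hpos] with x h1 h2
      rw [ENNReal.ofReal_rpow_of_pos h2, h1]
    -- The exponents agree because `q (1 - q') = -q'`.
    · congr 1
      refine lintegral_congr_ae (ae_restrict_of_ae ?_)
      filter_upwards [hww', hpos] with x h1 h2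
      rw [ENNReal.ofReal_rpow_of_pos h2, h1, ← Real.rpow_mul h2.le]
      congr 2
      have : q - 1 ≠ 0 := by linarith
      simp only [Real.conjExponent]
      field_simp
      ring
-- Dyadic bumps and their weighted bounds, uniform in the scale
/-- The profile `2^{jn} (1 + 2^j |x|)^{-n-1}`. -/
noncomputable def dyadicBump {n : ℕ} (j : ℤ) (x : EuclideanSpace ℝ (Fin n)) : ℝ :=
  ((2 : ℝ) ^ j) ^ n * ((1 + (2 : ℝ) ^ j * ‖x‖) ^ (n + 1))⁻¹

theorem continuous_dyadicBump {n : ℕ} (j : ℤ) :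
    Continuous (dyadicBump j : EuclideanSpace ℝ (Fin n) → ℝ) := by
  unfold dyadicBump
  refine continuous_const.mul (Continuous.inv₀ (by fun_prop) fun x => ?_)
  positivity

/-- Convolution of a nonnegative function with `dyadicBump j`. -/
noncomputable def smoothing {n : ℕ} (j : ℤ) (f : EuclideanSpace ℝ (Fin n) → ℝ≥0∞)
    (x : EuclideanSpace ℝ (Fin n)) : ℝ≥0∞ :=
  ∫⁻ y, ENNReal.ofReal (dyadicBump j (x - y)) * f y

theorem measurable_smoothing {n : ℕ} (j : ℤ) {f : EuclideanSpace ℝ (Fin n) → ℝ≥0∞}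
    (hf : Measurable f) : Measurable (smoothing j f) := by
  unfold smoothing
  refine Measurable.lintegral_prod_right' (f := fun z : EuclideanSpace ℝ (Fin n) ×
    EuclideanSpace ℝ (Fin n) => ENNReal.ofReal (dyadicBump j (z.1 - z.2)) * f z.2) ?_
  have := (continuous_dyadicBump (n := n) j).measurable
  fun_prop

theorem exists_nat_two_pow_bounds {a : ℝ} (ha : 0 ≤ a) :
    ∃ m : ℕ, a < 2 ^ m ∧ (2 : ℝ) ^ m ≤ 2 * (1 + a) := by
  have hex : ∃ m : ℕ, a < 2 ^ m := pow_unbounded_of_one_lt a one_lt_two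
  classical
  refine ⟨Nat.find hex, Nat.find_spec hex, ?_⟩
  rcases h : Nat.find hex with _ | k
  · simp; linarith
  · have := Nat.find_min hex (m := k) (by omega)
    push Not at this
    rw [pow_succ]
    linarith

/-- A single term suffices: the one with `2^m` comparable to `1 + 2^j |x - y|`. Of the `n + 1`
powers of decay, `n` normalize the ball of radius `2^{m-j}` and the last gives the summable factor
`2^{-m}`. -/
theorem dyadicBump_le_tsum {n : ℕ} (j : ℤ) (x y : EuclideanSpace ℝ (Fin n)) :
    ENNReal.ofReal (dyadicBump j (x - y)) ≤ ∑' m : ℕ, ENNReal.ofReal (2 ^ (n + 1) * 2⁻¹ ^ m) *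
      (ENNReal.ofReal (((2 : ℝ) ^ ((m : ℤ) - j)) ^ (-(n : ℝ))) *
        (Metric.ball x ((2 : ℝ) ^ ((m : ℤ) - j))).indicator 1 y) := by
  obtain ⟨m, h1, h2⟩ := exists_nat_two_pow_bounds (a := (2 : ℝ) ^ j * ‖x - y‖) (by positivity)
  refine le_trans ?_ (ENNReal.le_tsum m)
  have hj : (0 : ℝ) < 2 ^ j := by positivity
  have hy : y ∈ Metric.ball x ((2 : ℝ) ^ ((m : ℤ) - j)) := by
    rw [Metric.mem_ball', dist_eq_norm, zpow_sub₀ two_ne_zero, lt_div_iff₀ hj, zpow_natCast]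
    linarith
  rw [indicator_of_mem hy, Pi.one_apply, mul_one, ← ENNReal.ofReal_mul (by positivity)]
  refine ENNReal.ofReal_le_ofReal ?_
  rw [Real.rpow_neg (by positivity), Real.rpow_natCast, zpow_sub₀ two_ne_zero, zpow_natCast,
    div_pow, inv_div, dyadicBump]
  have e : (2 : ℝ) ^ (n + 1) * 2⁻¹ ^ m * (((2 : ℝ) ^ j) ^ n / (2 ^ m) ^ n) =
      ((2 : ℝ) ^ j) ^ n * ((2 ^ m / 2) ^ (n + 1))⁻¹ := by
    rw [div_pow, inv_div, pow_succ ((2 : ℝ) ^ m), inv_pow]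
    field_simp
  rw [e]
  gcongr
  linarith

theorem smoothing_le_tsum_ballAverage {n : ℕ} (j : ℤ) {f : EuclideanSpace ℝ (Fin n) → ℝ≥0∞}
    (hf : Measurable f) (x : EuclideanSpace ℝ (Fin n)) :
    smoothing j f x ≤ ∑' m : ℕ, ENNReal.ofReal (2 ^ (n + 1) * 2⁻¹ ^ m) *
      ballAverage ((2 : ℝ) ^ ((m : ℤ) - j)) f x := by
  calc smoothing j f x ≤ ∫⁻ y, ∑' m : ℕ, ENNReal.ofReal (2 ^ (n + 1) * 2⁻¹ ^ m) *
      (ENNReal.ofReal (((2 : ℝ) ^ ((m : ℤ) - j)) ^ (-(n : ℝ))) *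
        (Metric.ball x ((2 : ℝ) ^ ((m : ℤ) - j))).indicator f y) := by
        refine lintegral_mono fun y => ?_
        refine (mul_le_mul_left (dyadicBump_le_tsum j x y) _).trans_eq ?_
        rw [← ENNReal.tsum_mul_right]
        refine tsum_congr fun m => ?_
        by_cases hy : y ∈ Metric.ball x ((2 : ℝ) ^ ((m : ℤ) - j))
        · rw [indicator_of_mem hy, indicator_of_mem hy, Pi.one_apply, mul_one, mul_assoc]
        · rw [indicator_of_notMem hy, indicator_of_notMem hy]; simp
    _ = _ := by
        have hm : ∀ r : ℝ, Measurable ((Metric.ball x r).indicator f) := fun r =>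
          hf.indicator Metric.isOpen_ball.measurableSet
        rw [lintegral_tsum fun m => (((hm _).const_mul _).const_mul _).aemeasurable]
        refine tsum_congr fun m => ?_
        rw [lintegral_const_mul _ ((hm _).const_mul _), lintegral_const_mul _ (hm _),
          lintegral_indicator Metric.isOpen_ball.measurableSet, ballAverage]

theorem tsum_ofReal_geometric (n : ℕ) :
    ∑' m : ℕ, ENNReal.ofReal (2 ^ (n + 1) * 2⁻¹ ^ m) = 2 ^ (n + 2) := by
  have h : Summable fun m : ℕ => (2 : ℝ) ^ (n + 1) * 2⁻¹ ^ m :=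
    (summable_geometric_of_lt_one (by norm_num) (by norm_num)).mul_left _
  rw [← ENNReal.ofReal_tsum_of_nonneg (fun m => by positivity) h, tsum_mul_left,
    tsum_geometric_of_lt_one (by norm_num) (by norm_num)]
  norm_num
  rw [← pow_succ]

/-- The operators `smoothing j` are bounded on `L^q` with weight `W`, uniformly in `j`. -/
def SmoothingBounded {n : ℕ} (W : EuclideanSpace ℝ (Fin n) → ℝ≥0∞) (q : ℝ≥0∞) : Prop :=
  ∃ C : ℝ≥0, ∀ (j : ℤ) (f : EuclideanSpace ℝ (Fin n) → ℝ≥0∞), Measurable f →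
    eLpNorm (fun x => W x * smoothing j f x) q volume ≤
      C * eLpNorm (fun x => W x * f x) q volume

/-- The bound for ball averages does not depend on the radius, so it can be summed against the
geometric weights. -/
theorem Muckenhoupt.smoothingBounded {n : ℕ} {q : ℝ} (hq : 1 < q)
    {w : EuclideanSpace ℝ (Fin n) → ℝ} (hw : IsWeight w) (hA : Muckenhoupt q fun x => w x ^ q) :
    SmoothingBounded (fun x => ENNReal.ofReal (w x)) (ENNReal.ofReal q) := by
  obtain ⟨C, hC⟩ := eLpNorm_ballAverage_le hq hw hA
  have hq1 : 1 ≤ ENNReal.ofReal q := by simpa using hq.le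
  have hwm : AEMeasurable (fun x => ENNReal.ofReal (w x)) volume := hw.1.ennreal_ofReal
  refine ⟨2 ^ (n + 2) * C, fun j f hf => ?_⟩
  calc eLpNorm (fun x => ENNReal.ofReal (w x) * smoothing j f x) (ENNReal.ofReal q) volume
      ≤ eLpNorm (fun x => ∑' m : ℕ, ENNReal.ofReal (2 ^ (n + 1) * 2⁻¹ ^ m) *
          (ENNReal.ofReal (w x) * ballAverage ((2 : ℝ) ^ ((m : ℤ) - j)) f x))
          (ENNReal.ofReal q) volume := by
        refine eLpNorm_ennreal_mono_ae (Eventually.of_forall fun x => ?_)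
        refine (mul_le_mul_right (smoothing_le_tsum_ballAverage j hf x) _).trans_eq ?_
        rw [← ENNReal.tsum_mul_left]
        exact tsum_congr fun m => mul_left_comm _ _ _
    _ ≤ ∑' m : ℕ, ENNReal.ofReal (2 ^ (n + 1) * 2⁻¹ ^ m) *
          (C * eLpNorm (fun x => ENNReal.ofReal (w x) * f x) (ENNReal.ofReal q) volume) := by
        have hm : ∀ m : ℕ, AEMeasurable (fun x => ENNReal.ofReal (w x) *
            ballAverage ((2 : ℝ) ^ ((m : ℤ) - j)) f x) volume := fun m =>
          hwm.mul (measurable_ballAverage _ hf).aemeasurable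
        refine (eLpNorm_ennreal_tsum_le (fun m => (hm m).const_mul _) hq1).trans ?_
        refine ENNReal.tsum_le_tsum fun m => ?_
        refine (eLpNorm_ennreal_const_mul (hm m) _ hq1).trans ?_
        gcongr
        exact hC _ (by positivity) f hf
    _ = _ := by
        rw [ENNReal.tsum_mul_right, tsum_ofReal_geometric]
        push_cast
        ring

/-- A function with `w f ≤ A` is at most `A w⁻¹`, and every ball average of `w⁻¹` at `x` is at most
a constant times `w⁻¹(x)` by `A_1`. -/
theorem MuckenhouptOne.smoothingBounded {n : ℕ} {w : EuclideanSpace ℝ (Fin n) → ℝ}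
    (hw : IsWeight w) (hA : MuckenhouptOne fun x => (w x)⁻¹) :
    SmoothingBounded (fun x => ENNReal.ofReal (w x)) ⊤ := by
  obtain ⟨-, C, hC⟩ := hA
  refine ⟨2 ^ (n + 2) * C, fun j f hf => ?_⟩
  set A := eLpNorm (fun x => ENNReal.ofReal (w x) * f x) ⊤ volume
  have hA : ∀ᵐ x, f x ≤ A * ENNReal.ofReal (w x)⁻¹ := by
    have h1 : ∀ᵐ x, ENNReal.ofReal (w x) * f x ≤ A := by
      simpa [A, eLpNorm_exponent_top, eLpNormEssSup] using
        ENNReal.ae_le_essSup fun x => ENNReal.ofReal (w x) * f x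
    filter_upwards [h1, hw.2] with x hx hx0
    rw [ENNReal.ofReal_inv_of_pos hx0, ← div_eq_mul_inv,
      ENNReal.le_div_iff_mul_le (Or.inl (by simpa using hx0)) (Or.inl ENNReal.ofReal_ne_top),
      mul_comm]
    exact hx
  have hwm : AEMeasurable (fun x => ENNReal.ofReal (w x)⁻¹) volume := hw.1.inv.ennreal_ofReal
  rw [eLpNorm_exponent_top, eLpNormEssSup]
  refine essSup_le_of_ae_le _ ?_
  filter_upwards [hC, hw.2] with x hx hx0
  have hav : ∀ r : ℝ, 0 < r → ballAverage r f x ≤ A * (C * ENNReal.ofReal (w x)⁻¹) := by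
    intro r hr
    calc ballAverage r f x ≤ ENNReal.ofReal (r ^ (-(n : ℝ))) *
          ∫⁻ y in Metric.ball x r, A * ENNReal.ofReal (w y)⁻¹ := by
          rw [ballAverage]
          exact mul_le_mul' le_rfl (lintegral_mono_ae (ae_restrict_of_ae hA))
      _ = A * (ENNReal.ofReal (r ^ (-(n : ℝ))) *
          ∫⁻ y in Metric.ball x r, ENNReal.ofReal (w y)⁻¹) := by
          rw [lintegral_const_mul'' _ hwm.restrict, mul_left_comm]
      _ ≤ A * (C * ENNReal.ofReal (w x)⁻¹) := by
          refine mul_le_mul' le_rfl (le_trans ?_ hx)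
          exact le_iSup₂ (f := fun (r : ℝ) (_ : 0 < r) => ENNReal.ofReal (r ^ (-(n : ℝ))) *
            ∫⁻ y in Metric.ball x r, ENNReal.ofReal (w y)⁻¹) r hr
  calc ‖ENNReal.ofReal (w x) * smoothing j f x‖ₑ
      ≤ ENNReal.ofReal (w x) * ∑' m : ℕ, ENNReal.ofReal (2 ^ (n + 1) * 2⁻¹ ^ m) *
          (A * (C * ENNReal.ofReal (w x)⁻¹)) := by
        rw [enorm_eq_self]
        gcongr
        refine (smoothing_le_tsum_ballAverage j hf x).trans (ENNReal.tsum_le_tsum fun m => ?_)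
        gcongr
        exact hav _ (by positivity)
    _ = 2 ^ (n + 2) * C * A * (ENNReal.ofReal (w x) * ENNReal.ofReal (w x)⁻¹) := by
        rw [ENNReal.tsum_mul_right, tsum_ofReal_geometric]
        ring
    _ = _ := by
        rw [← ENNReal.ofReal_mul hx0.le, mul_inv_cancel₀ hx0.ne']
        simp

/-! ### The Littlewood-Paley kernel: smoothness, scaling, cancellation, reproduction -/

theorem IsLittlewoodPaley.eventually_eq_zero {φ : ℝ → ℝ} (hφ : IsLittlewoodPaley φ) :
    φ =ᶠ[𝓝 0] 0 :=
  notMem_tsupport_iff_eventuallyEq.1 fun h => lt_irrefl (0 : ℝ) (hφ.support_pos h)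

theorem IsLittlewoodPaley.exists_radius {φ : ℝ → ℝ} (hφ : IsLittlewoodPaley φ) :
    ∃ R : ℝ, 0 < R ∧ ∀ ρ, R < ρ → φ ρ = 0 := by
  obtain ⟨R, hR⟩ := hφ.compact.isCompact.bddAbove
  refine ⟨max R 1, by positivity, fun ρ h => image_eq_zero_of_notMem_tsupport fun hm => ?_⟩
  exact absurd (hR hm) (not_le.2 ((le_max_left _ _).trans_lt h))

theorem lpSymbol_zero_eq {n : ℕ} (φ : ℝ → ℝ) (ξ : EuclideanSpace ℝ (Fin n)) :
    lpSymbol φ 0 ξ = φ (2 * Real.pi * ‖ξ‖) := by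
  simp [lpSymbol]

theorem lpSymbol_eq_zero_of_lt {n : ℕ} {φ : ℝ → ℝ} {R : ℝ} (hR : ∀ ρ, R < ρ → φ ρ = 0)
    {ξ : EuclideanSpace ℝ (Fin n)} (h : R < ‖ξ‖) : lpSymbol φ 0 ξ = 0 := by
  rw [lpSymbol_zero_eq]
  refine hR _ (h.trans_le ?_)
  have := Real.pi_gt_three
  nlinarith [norm_nonneg ξ]

/-- The norm is singular only at the origin, and `φ` vanishes near `0`. -/
theorem contDiff_lpSymbol {n : ℕ} {φ : ℝ → ℝ} (hφ : IsLittlewoodPaley φ) :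
    ContDiff ℝ ∞ (lpSymbol φ 0 : EuclideanSpace ℝ (Fin n) → ℝ) := by
  rw [contDiff_iff_contDiffAt]
  intro ξ
  have e : (lpSymbol φ 0 : EuclideanSpace ℝ (Fin n) → ℝ) = fun ξ => φ (2 * Real.pi * ‖ξ‖) :=
    funext fun ξ => lpSymbol_zero_eq φ ξ
  rw [e]
  by_cases h : ξ = 0
  · subst h
    refine (contDiffAt_const (c := (0 : ℝ))).congr_of_eventuallyEq ?_
    have : Tendsto (fun ξ : EuclideanSpace ℝ (Fin n) => 2 * Real.pi * ‖ξ‖) (𝓝 0) (𝓝 0) := by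
      have : Continuous fun ξ : EuclideanSpace ℝ (Fin n) => 2 * Real.pi * ‖ξ‖ := by fun_prop
      simpa using this.tendsto 0
    exact this.eventually hφ.eventually_eq_zero
  · exact hφ.smooth.contDiffAt.comp ξ (contDiffAt_const.mul (contDiffAt_norm ℝ h))

/-- The symbol of `P_0` as a Schwartz function. -/
noncomputable def lpSymbolSchwartz (n : ℕ) {φ : ℝ → ℝ} (hφ : IsLittlewoodPaley φ) :
    𝓢(EuclideanSpace ℝ (Fin n), ℂ) :=
  HasCompactSupport.toSchwartzMap (f := fun ξ => ((lpSymbol φ 0 ξ : ℝ) : ℂ))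
    (by
      obtain ⟨R, -, hR⟩ := hφ.exists_radius
      refine HasCompactSupport.intro (isCompact_closedBall 0 R) fun ξ hξ => ?_
      rw [mem_closedBall_zero_iff, not_le] at hξ
      simp [lpSymbol_eq_zero_of_lt hR hξ])
    (Complex.ofRealCLM.contDiff.comp (contDiff_lpSymbol hφ))

@[simp] theorem lpSymbolSchwartz_apply {n : ℕ} {φ : ℝ → ℝ} (hφ : IsLittlewoodPaley φ)
    (ξ : EuclideanSpace ℝ (Fin n)) : lpSymbolSchwartz n hφ ξ = ((lpSymbol φ 0 ξ : ℝ) : ℂ) := rfl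

theorem lpKernel_zero_eq {n : ℕ} {φ : ℝ → ℝ} (hφ : IsLittlewoodPaley φ)
    (x : EuclideanSpace ℝ (Fin n)) :
    ((lpKernel φ 0 x : ℝ) : ℂ) = 𝓕⁻ (lpSymbolSchwartz n hφ) x := by
  rw [lpKernel_eq, SchwartzMap.fourierInv_coe]
  rfl

theorem lpKernel_scale {n : ℕ} (φ : ℝ → ℝ) (j : ℤ) (x : EuclideanSpace ℝ (Fin n)) :
    lpKernel φ j x = ((2 : ℝ) ^ j) ^ n * lpKernel φ 0 ((2 : ℝ) ^ j • x) := by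
  have h : (0 : ℝ) < 2 ^ j := by positivity
  apply Complex.ofReal_injective
  push_cast
  rw [lpKernel_eq, lpKernel_eq, Real.fourierInv_eq', Real.fourierInv_eq']
  have := Measure.integral_comp_smul (volume : Measure (EuclideanSpace ℝ (Fin n)))
    (fun v => Complex.exp ((↑(2 * Real.pi * inner ℝ v ((2 : ℝ) ^ j • x)) * Complex.I)) •
      ((lpSymbol φ 0 v : ℝ) : ℂ)) ((2 : ℝ) ^ (-j))
  have e : ∀ v : EuclideanSpace ℝ (Fin n),
      Complex.exp ((↑(2 * Real.pi * inner ℝ ((2 : ℝ) ^ (-j) • v) ((2 : ℝ) ^ j • x)) * Complex.I)) •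
        ((lpSymbol φ 0 ((2 : ℝ) ^ (-j) • v) : ℝ) : ℂ) =
      Complex.exp ((↑(2 * Real.pi * inner ℝ v x) * Complex.I)) • ((lpSymbol φ j v : ℝ) : ℂ) := by
    intro v
    have e1 : lpSymbol φ 0 ((2 : ℝ) ^ (-j) • v) = lpSymbol φ j v := by
      have h' : (0 : ℝ) < 2 ^ (-j) := by positivity
      rw [lpSymbol_zero_eq, lpSymbol, norm_smul, Real.norm_of_nonneg h'.le]
      congr 1
      ring
    have e2 : inner ℝ ((2 : ℝ) ^ (-j) • v) ((2 : ℝ) ^ j • x) = inner ℝ v x := by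
      rw [inner_smul_left, inner_smul_right, zpow_neg]
      simp only [conj_trivial]
      field_simp
    rw [e1, e2]
  simp_rw [e] at this
  rw [this]
  simp only [finrank_euclideanSpace, Fintype.card_fin, zpow_neg, inv_pow, inv_inv]
  rw [abs_of_pos (by positivity), Complex.real_smul]
  push_cast
  rfl

theorem SchwartzMap.exists_norm_le {E F : Type*} [NormedAddCommGroup E] [NormedSpace ℝ E]
    [NormedAddCommGroup F] [NormedSpace ℝ F] (f : 𝓢(E, F)) (N : ℕ) :
    ∃ C : ℝ, 0 ≤ C ∧ ∀ x, ‖f x‖ ≤ C * ((1 + ‖x‖) ^ N)⁻¹ := by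
  refine ⟨2 ^ N * (Finset.Iic (N, 0)).sup (fun m => SchwartzMap.seminorm ℝ m.1 m.2) f,
    by positivity, fun x => ?_⟩
  have := SchwartzMap.one_add_le_sup_seminorm_apply (𝕜 := ℝ) (m := (N, 0)) le_rfl le_rfl f x
  rw [norm_iteratedFDeriv_zero] at this
  rw [← div_eq_mul_inv, le_div_iff₀ (by positivity)]
  linarith

theorem SchwartzMap.exists_norm_fderiv_le {E F : Type*} [NormedAddCommGroup E] [NormedSpace ℝ E]
    [NormedAddCommGroup F] [NormedSpace ℝ F] (f : 𝓢(E, F)) (N : ℕ) :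
    ∃ C : ℝ, 0 ≤ C ∧ ∀ x, ‖fderiv ℝ f x‖ ≤ C * ((1 + ‖x‖) ^ N)⁻¹ := by
  obtain ⟨C, h0, hC⟩ := SchwartzMap.exists_norm_le (SchwartzMap.fderivCLM ℝ E F f) N
  exact ⟨C, h0, fun x => by simpa using hC x⟩

/-- Mean value inequality on the segment from `x` to `z`. The decay of the derivative at an
intermediate point is moved to `x` at the cost of a power of `1 + ‖z - x‖`. -/
theorem SchwartzMap.exists_norm_sub_le {E F : Type*} [NormedAddCommGroup E] [NormedSpace ℝ E]
    [NormedAddCommGroup F] [NormedSpace ℝ F] (f : 𝓢(E, F)) (N : ℕ) :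
    ∃ C : ℝ, 0 ≤ C ∧ ∀ x z, ‖f z - f x‖ ≤
      C * (‖z - x‖ * (1 + ‖z - x‖) ^ N) * ((1 + ‖x‖) ^ N)⁻¹ := by
  obtain ⟨C, h0, hC⟩ := f.exists_norm_fderiv_le N
  refine ⟨C, h0, fun x z => ?_⟩
  have key : ∀ c ∈ segment ℝ x z, ‖fderiv ℝ f c‖ ≤ C * ((1 + ‖z - x‖) ^ N * ((1 + ‖x‖) ^ N)⁻¹) := by
    intro c hc
    refine (hC c).trans (mul_le_mul_of_nonneg_left ?_ h0)
    have h1 : ‖c - x‖ ≤ ‖z - x‖ := by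
      have := norm_sub_le_of_mem_segment hc
      simpa using this
    have h2 : 1 + ‖x‖ ≤ (1 + ‖z - x‖) * (1 + ‖c‖) := by
      have : ‖x‖ ≤ ‖c‖ + ‖c - x‖ := by
        have := norm_sub_norm_le x c
        rw [norm_sub_rev] at this
        linarith
      nlinarith [norm_nonneg c, norm_nonneg (z - x)]
    rw [← div_eq_mul_inv, le_div_iff₀ (by positivity), mul_comm, ← div_eq_mul_inv,
      div_le_iff₀ (by positivity), ← mul_pow]
    gcongr
  have := (convex_segment x z).norm_image_sub_le_of_norm_fderiv_le
    (fun c _ => f.differentiableAt) key (left_mem_segment ℝ x z) (right_mem_segment ℝ x z)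
  refine this.trans_eq ?_
  ring

/-- The integral of `K_0` is its symbol at the origin, where `φ` vanishes; other `j` follow by
scaling. -/
theorem integral_lpKernel {n : ℕ} {φ : ℝ → ℝ} (hφ : IsLittlewoodPaley φ) (j : ℤ) :
    ∫ x : EuclideanSpace ℝ (Fin n), lpKernel φ j x = 0 := by
  have h0 : ∫ x : EuclideanSpace ℝ (Fin n), lpKernel φ 0 x = 0 := by
    apply Complex.ofReal_injective
    rw [← integral_complex_ofReal]
    simp_rw [lpKernel_zero_eq hφ]
    have h1 : 𝓕 (𝓕⁻ (lpSymbolSchwartz n hφ)) 0 = lpSymbolSchwartz n hφ 0 := by simp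
    rw [SchwartzMap.fourier_coe, Real.fourier_eq'] at h1
    simp only [inner_zero_right, mul_zero, Complex.ofReal_zero, zero_mul, Complex.exp_zero,
      one_smul] at h1
    rw [h1, lpSymbolSchwartz_apply, lpSymbol_zero_eq]
    simpa using hφ.eventually_eq_zero.self_of_nhds
  simp_rw [lpKernel_scale φ j]
  rw [integral_const_mul, Measure.integral_comp_smul, h0]
  simp

/-- A reproducing kernel for `P_0`: a Schwartz function `κ` with `κ * K_0 = K_0`. -/
theorem exists_reproducing_kernel {n : ℕ} {φ : ℝ → ℝ} (hφ : IsLittlewoodPaley φ) :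
    ∃ f : 𝓢(EuclideanSpace ℝ (Fin n), ℂ), ∀ x,
      ∫ y, (f (x - y)).re * lpKernel φ 0 y = lpKernel φ 0 x := by
  obtain ⟨R, hR0, hR⟩ := hφ.exists_radius
  -- A cutoff equal to `1` on the support of the symbol, so multiplying by it changes nothing; on
  -- the kernel side this is convolution with `𝓕⁻ χ`.
  let b : ContDiffBump (0 : EuclideanSpace ℝ (Fin n)) := ⟨R, R + 1, hR0, by linarith⟩
  let χ : 𝓢(EuclideanSpace ℝ (Fin n), ℂ) :=
    HasCompactSupport.toSchwartzMap (f := fun ξ => ((b ξ : ℝ) : ℂ))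
      (b.hasCompactSupport.comp_left (g := fun r : ℝ => (r : ℂ)) (by simp))
      (Complex.ofRealCLM.contDiff.comp b.contDiff)
  have hχ : ∀ ξ, χ ξ * lpSymbolSchwartz n hφ ξ = lpSymbolSchwartz n hφ ξ := by
    intro ξ
    change ((b ξ : ℝ) : ℂ) * _ = _
    by_cases h : R < ‖ξ‖
    · simp [lpSymbol_eq_zero_of_lt hR h]
    · rw [b.one_of_mem_closedBall (by simpa using not_lt.1 h)]
      simp
  have hconv : SchwartzMap.convolution (ContinuousLinearMap.mul ℂ ℂ) (𝓕⁻ (lpSymbolSchwartz n hφ))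
      (𝓕⁻ χ) = 𝓕⁻ (lpSymbolSchwartz n hφ) := by
    have hF : 𝓕 (SchwartzMap.convolution (ContinuousLinearMap.mul ℂ ℂ)
        (𝓕⁻ (lpSymbolSchwartz n hφ)) (𝓕⁻ χ)) = lpSymbolSchwartz n hφ := by
      rw [SchwartzMap.fourier_convolution]
      ext ξ
      simp only [FourierTransform.fourier_fourierInv_eq, SchwartzMap.pairing_apply_apply,
        ContinuousLinearMap.mul_apply']
      rw [mul_comm]
      exact hχ ξ
    have := congrArg (fun g => 𝓕⁻ g) hF
    simpa only [FourierTransform.fourierInv_fourier_eq] using this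
  refine ⟨𝓕⁻ χ, fun x => ?_⟩
  have h1 := SchwartzMap.convolution_apply (ContinuousLinearMap.mul ℂ ℂ)
    (𝓕⁻ (lpSymbolSchwartz n hφ)) (𝓕⁻ χ) x
  rw [hconv, ← lpKernel_zero_eq hφ, MeasureTheory.convolution_def] at h1
  simp only [ContinuousLinearMap.mul_apply', ← lpKernel_zero_eq hφ] at h1
  have hint : Integrable fun y => ((lpKernel φ 0 y : ℝ) : ℂ) * 𝓕⁻ χ (x - y) := by
    have hb : Integrable fun y => 𝓕⁻ (lpSymbolSchwartz n hφ) y * 𝓕⁻ χ (x - y) := by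
      obtain ⟨C, -, hC⟩ := (𝓕⁻ χ).exists_norm_le 0
      refine (𝓕⁻ (lpSymbolSchwartz n hφ)).integrable.mul_bdd (c := C) ?_ ?_
      · exact ((𝓕⁻ χ).continuous.comp (by fun_prop)).aestronglyMeasurable
      · exact Eventually.of_forall fun y => by simpa using hC (x - y)
    simpa only [← lpKernel_zero_eq hφ] using hb
  have h2 := congrArg Complex.re h1
  rw [Complex.ofReal_re] at h2
  rw [h2]
  have h3 := integral_re hint
  simp only [RCLike.re_to_complex] at h3
  rw [← h3]
  refine integral_congr_ae (Eventually.of_forall fun y => ?_)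
  simp only [Complex.re_ofReal_mul]
  ring

/-- The `L^1`-normalized dyadic dilation `2^{jn} f (2^j x)`. -/
noncomputable def dyadicDilation {n : ℕ} (j : ℤ) (f : EuclideanSpace ℝ (Fin n) → ℝ)
    (x : EuclideanSpace ℝ (Fin n)) : ℝ :=
  ((2 : ℝ) ^ j) ^ n * f ((2 : ℝ) ^ j • x)

theorem lpKernel_eq_dyadicDilation {n : ℕ} (φ : ℝ → ℝ) (j : ℤ) :
    (lpKernel φ j : EuclideanSpace ℝ (Fin n) → ℝ) = dyadicDilation j (lpKernel φ 0) :=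
  funext fun x => lpKernel_scale φ j x

theorem lpKernel_zero_eq_re {n : ℕ} {φ : ℝ → ℝ} (hφ : IsLittlewoodPaley φ) :
    (lpKernel φ 0 : EuclideanSpace ℝ (Fin n) → ℝ) =
      fun x => (𝓕⁻ (lpSymbolSchwartz n hφ) x).re := by
  ext x
  rw [← lpKernel_zero_eq hφ, Complex.ofReal_re]

theorem continuous_dyadicDilation {n : ℕ} (j : ℤ) {f : EuclideanSpace ℝ (Fin n) → ℝ}
    (hf : Continuous f) : Continuous (dyadicDilation j f) := by
  unfold dyadicDilation; fun_prop

theorem norm_two_zpow_smul {n : ℕ} (j : ℤ) (x : EuclideanSpace ℝ (Fin n)) :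
    ‖(2 : ℝ) ^ j • x‖ = (2 : ℝ) ^ j * ‖x‖ := by
  rw [norm_smul, Real.norm_of_nonneg (by positivity)]

theorem SchwartzMap.exists_abs_dyadicDilation_le {n : ℕ}
    (f : 𝓢(EuclideanSpace ℝ (Fin n), ℂ)) (N : ℕ) :
    ∃ C : ℝ, 0 ≤ C ∧ ∀ (j : ℤ) (x : EuclideanSpace ℝ (Fin n)),
      |dyadicDilation j (fun x => (f x).re) x| ≤
        C * (((2 : ℝ) ^ j) ^ n * ((1 + (2 : ℝ) ^ j * ‖x‖) ^ N)⁻¹) := by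
  obtain ⟨C, h0, hC⟩ := f.exists_norm_le N
  refine ⟨C, h0, fun j x => ?_⟩
  have h1 := (Complex.abs_re_le_norm _).trans (hC ((2 : ℝ) ^ j • x))
  rw [norm_two_zpow_smul] at h1
  rw [dyadicDilation, abs_mul, abs_of_pos (by positivity), mul_left_comm C]
  gcongr

/-- Applied to the reproducing kernel, this transfers smoothness at scale `2^{-j}` to `P_j f`. -/
theorem SchwartzMap.exists_abs_dyadicDilation_sub_le {n : ℕ}
    (f : 𝓢(EuclideanSpace ℝ (Fin n), ℂ)) :
    ∃ C : ℝ, 0 ≤ C ∧ ∀ (j : ℤ) (x z : EuclideanSpace ℝ (Fin n)),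
      |dyadicDilation j (fun x => (f x).re) z - dyadicDilation j (fun x => (f x).re) x| ≤
        C * ((2 : ℝ) ^ j * ‖z - x‖ * (1 + (2 : ℝ) ^ j * ‖z - x‖) ^ (n + 1)) * dyadicBump j x := by
  obtain ⟨C, h0, hC⟩ := f.exists_norm_sub_le (n + 1)
  refine ⟨C, h0, fun j x z => ?_⟩
  have h1 := (Complex.abs_re_le_norm _).trans (hC ((2 : ℝ) ^ j • x) ((2 : ℝ) ^ j • z))
  rw [← smul_sub, norm_two_zpow_smul, norm_two_zpow_smul, Complex.sub_re] at h1
  rw [dyadicDilation, dyadicDilation, ← mul_sub, abs_mul, abs_of_pos (by positivity), dyadicBump,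
    mul_left_comm]
  gcongr

/-- Serves only to prove integrability, so the constant may depend on `j`. -/
theorem SchwartzMap.exists_abs_dyadicDilation_le_unscaled {n : ℕ}
    (f : 𝓢(EuclideanSpace ℝ (Fin n), ℂ)) (j : ℤ) (N : ℕ) :
    ∃ C : ℝ, 0 ≤ C ∧ ∀ x : EuclideanSpace ℝ (Fin n),
      |dyadicDilation j (fun x => (f x).re) x| ≤ C * ((1 + ‖x‖) ^ N)⁻¹ := by
  obtain ⟨C, h0, hC⟩ := f.exists_abs_dyadicDilation_le N
  refine ⟨C * (((2 : ℝ) ^ j) ^ n * (1 + ((2 : ℝ) ^ j)⁻¹) ^ N), by positivity, fun x => ?_⟩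
  refine (hC j x).trans ?_
  rw [mul_assoc, mul_assoc]
  gcongr
  have h2 : (0 : ℝ) < 2 ^ j := by positivity
  rw [← div_eq_mul_inv, le_div_iff₀ (by positivity), mul_comm, ← div_eq_mul_inv,
    div_le_iff₀ (by positivity), ← mul_pow]
  gcongr
  have h3 : ((2 : ℝ) ^ j)⁻¹ * ((2 : ℝ) ^ j * ‖x‖) = ‖x‖ := by field_simp
  have : 0 ≤ (2 : ℝ) ^ j * ‖x‖ := by positivity
  have : 0 < ((2 : ℝ) ^ j)⁻¹ := by positivity
  nlinarith

theorem integral_dyadicDilation_mul {n : ℕ} {κ K : EuclideanSpace ℝ (Fin n) → ℝ}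
    (h : ∀ x, ∫ y, κ (x - y) * K y = K x) (j : ℤ) (x : EuclideanSpace ℝ (Fin n)) :
    ∫ y, dyadicDilation j κ (x - y) * dyadicDilation j K y = dyadicDilation j K x := by
  have h2 : (0 : ℝ) < 2 ^ j := by positivity
  have e : ∀ y, dyadicDilation j κ (x - y) * dyadicDilation j K y =
      (((2 : ℝ) ^ j) ^ n * ((2 : ℝ) ^ j) ^ n) *
        (fun y => κ ((2 : ℝ) ^ j • x - y) * K y) ((2 : ℝ) ^ j • y) := by
    intro y
    simp only [dyadicDilation, smul_sub]
    ring
  simp_rw [e]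
  have hc := Measure.integral_comp_smul (volume : Measure (EuclideanSpace ℝ (Fin n)))
    (fun y => κ ((2 : ℝ) ^ j • x - y) * K y) ((2 : ℝ) ^ j)
  simp only [h] at hc
  rw [integral_const_mul, hc, dyadicDilation, finrank_euclideanSpace, Fintype.card_fin, abs_of_pos (by positivity),
    smul_eq_mul]
  field_simp

theorem continuous_lpKernel {n : ℕ} {φ : ℝ → ℝ} (hφ : IsLittlewoodPaley φ) (j : ℤ) :
    Continuous (lpKernel φ j : EuclideanSpace ℝ (Fin n) → ℝ) := by
  rw [lpKernel_eq_dyadicDilation]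
  refine continuous_dyadicDilation j ?_
  rw [lpKernel_zero_eq_re hφ]
  exact Complex.continuous_re.comp (𝓕⁻ (lpSymbolSchwartz n hφ)).continuous

theorem exists_abs_lpKernel_le {n : ℕ} {φ : ℝ → ℝ} (hφ : IsLittlewoodPaley φ) (N : ℕ) :
    ∃ C : ℝ, 0 ≤ C ∧ ∀ (j : ℤ) (x : EuclideanSpace ℝ (Fin n)),
      |lpKernel φ j x| ≤ C * (((2 : ℝ) ^ j) ^ n * ((1 + (2 : ℝ) ^ j * ‖x‖) ^ N)⁻¹) := by
  obtain ⟨C, h0, hC⟩ := (𝓕⁻ (lpSymbolSchwartz n hφ)).exists_abs_dyadicDilation_le N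
  refine ⟨C, h0, fun j x => ?_⟩
  rw [lpKernel_eq_dyadicDilation φ, lpKernel_zero_eq_re hφ]
  exact hC j x

theorem exists_abs_lpKernel_le_unscaled {n : ℕ} {φ : ℝ → ℝ} (hφ : IsLittlewoodPaley φ)
    (j : ℤ) (N : ℕ) :
    ∃ C : ℝ, 0 ≤ C ∧ ∀ x : EuclideanSpace ℝ (Fin n),
      |lpKernel φ j x| ≤ C * ((1 + ‖x‖) ^ N)⁻¹ := by
  rw [lpKernel_eq_dyadicDilation φ, lpKernel_zero_eq_re hφ]
  exact (𝓕⁻ (lpSymbolSchwartz n hφ)).exists_abs_dyadicDilation_le_unscaled j N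

/-! ### The reproducing formula on tempered functions and increments of `P_j f` -/

theorem one_add_norm_le_mul {E : Type*} [NormedAddCommGroup E] (x y z : E) :
    1 + ‖z‖ ≤ (1 + ‖x‖) * ((1 + ‖x - y‖) * (1 + ‖y - z‖)) := by
  have h : ‖z‖ ≤ ‖x‖ + (‖x - y‖ + ‖y - z‖) := by
    have h1 : z = x - ((x - y) + (y - z)) := by abel
    calc ‖z‖ = ‖x - ((x - y) + (y - z))‖ := by rw [← h1]
      _ ≤ ‖x‖ + ‖(x - y) + (y - z)‖ := norm_sub_le _ _
      _ ≤ _ := by gcongr; exact norm_add_le _ _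
  have := norm_nonneg x
  have := norm_nonneg (x - y)
  have := norm_nonneg (y - z)
  have : 0 ≤ ‖x‖ * (‖x - y‖ + ‖y - z‖ + ‖x - y‖ * ‖y - z‖) := by positivity
  have : 0 ≤ ‖x - y‖ * ‖y - z‖ := by positivity
  nlinarith

theorem IsTemperedFun.aestronglyMeasurable {n m : ℕ}
    {f : EuclideanSpace ℝ (Fin n) → EuclideanSpace ℝ (Fin m)} (hf : IsTemperedFun f) :
    AEStronglyMeasurable f volume := by
  obtain ⟨N, hN⟩ := hf
  have hc : Continuous fun x : EuclideanSpace ℝ (Fin n) => (1 + ‖x‖) ^ (N : ℝ) :=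
    Continuous.rpow_const (by fun_prop) fun x => Or.inl (by positivity)
  refine (hc.aestronglyMeasurable.smul hN.1).congr (Eventually.of_forall fun x => ?_)
  simp only [Pi.smul_apply', smul_smul]
  rw [← Real.rpow_add (by positivity)]
  simp

/-- Justifies Fubini in `κ_j * (K_j * f)` for tempered `f`: the growth of `f` at `z` is absorbed by
the decay of the two kernels along the chain `x`, `y`, `z`. -/
theorem integrable_reproducing {n m : ℕ} {φ : ℝ → ℝ} (hφ : IsLittlewoodPaley φ)
    (κ : 𝓢(EuclideanSpace ℝ (Fin n), ℂ)) (j : ℤ)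
    {f : EuclideanSpace ℝ (Fin n) → EuclideanSpace ℝ (Fin m)} (hf : IsTemperedFun f)
    (x : EuclideanSpace ℝ (Fin n)) :
    Integrable (fun p : EuclideanSpace ℝ (Fin n) × EuclideanSpace ℝ (Fin n) =>
      dyadicDilation j (fun x => (κ x).re) (x - p.1) • lpKernel φ j (p.1 - p.2) • f p.2)
      (volume.prod volume) := by
  have hfm := hf.aestronglyMeasurable
  obtain ⟨N, hN⟩ := hf
  -- Order `n + 1` makes the kernel integrable in `y`; the remaining `N` join the decay of `K_j` to
  -- match the growth of `f`.
  obtain ⟨C₁, h₁, hC₁⟩ := κ.exists_abs_dyadicDilation_le_unscaled j (n + 1 + N)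
  obtain ⟨C₂, h₂, hC₂⟩ := exists_abs_lpKernel_le_unscaled (n := n) hφ j N
  have hi : Integrable (fun y : EuclideanSpace ℝ (Fin n) => (1 + ‖x - y‖) ^ (-((n + 1 : ℕ) : ℝ)))
      volume := by
    have := integrable_one_add_norm (E := EuclideanSpace ℝ (Fin n)) (μ := volume)
      (r := ((n + 1 : ℕ) : ℝ)) (by simp)
    exact this.comp_sub_left x
  have hprod := (hi.smul_prod hN).smul (C₁ * C₂ * (1 + ‖x‖) ^ N)
  refine hprod.mono ?_ (Eventually.of_forall fun p => ?_)
  · have m1 : Continuous fun p : EuclideanSpace ℝ (Fin n) × EuclideanSpace ℝ (Fin n) =>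
        dyadicDilation j (fun x => (κ x).re) (x - p.1) :=
      (continuous_dyadicDilation j (Complex.continuous_re.comp κ.continuous)).comp
        (continuous_const.sub continuous_fst)
    have m2 : Continuous fun p : EuclideanSpace ℝ (Fin n) × EuclideanSpace ℝ (Fin n) =>
        lpKernel φ j (p.1 - p.2) :=
      (continuous_lpKernel hφ j).comp (continuous_fst.sub continuous_snd)
    have m3 : AEStronglyMeasurable (fun p : EuclideanSpace ℝ (Fin n) × EuclideanSpace ℝ (Fin n) =>
        f p.2) (volume.prod volume) := hfm.comp_snd
    exact m1.aestronglyMeasurable.smul (m2.aestronglyMeasurable.smul m3)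
  · obtain ⟨y, z⟩ := p
    simp only [Pi.smul_apply, norm_smul, Real.norm_eq_abs]
    have a1 : |((1 + ‖x - y‖) ^ (n + 1))⁻¹| = ((1 + ‖x - y‖) ^ (n + 1))⁻¹ :=
      abs_of_nonneg (by positivity)
    have a2 : |((1 + ‖z‖) ^ N)⁻¹| = ((1 + ‖z‖) ^ N)⁻¹ := abs_of_nonneg (by positivity)
    rw [abs_of_nonneg (by positivity : 0 ≤ C₁ * C₂ * (1 + ‖x‖) ^ N), Real.rpow_neg (by positivity),
      Real.rpow_neg (by positivity), Real.rpow_natCast, Real.rpow_natCast,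
      a1, a2, ← mul_assoc, ← mul_assoc, ← mul_assoc]
    refine mul_le_mul_of_nonneg_right ?_ (norm_nonneg _)
    calc |dyadicDilation j (fun x => (κ x).re) (x - y)| * |lpKernel φ j (y - z)|
        ≤ C₁ * ((1 + ‖x - y‖) ^ (n + 1 + N))⁻¹ * (C₂ * ((1 + ‖y - z‖) ^ N)⁻¹) := by
          gcongr
          · exact hC₁ _
          · exact hC₂ _
      _ = C₁ * C₂ * ((1 + ‖x - y‖) ^ (n + 1))⁻¹ *
          (((1 + ‖x - y‖) * (1 + ‖y - z‖)) ^ N)⁻¹ := by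
          rw [pow_add, mul_pow, mul_inv, mul_inv]; ring
      _ ≤ C₁ * C₂ * ((1 + ‖x - y‖) ^ (n + 1))⁻¹ *
          ((1 + ‖x‖) ^ N * ((1 + ‖z‖) ^ N)⁻¹) := by
          gcongr
          rw [← div_eq_mul_inv, le_div_iff₀ (by positivity), mul_comm, ← div_eq_mul_inv,
            div_le_iff₀ (by positivity), ← mul_pow]
          gcongr
          exact one_add_norm_le_mul x y z
      _ = _ := by ring

/-- `P_j f` is reproduced by convolution with a smooth kernel. -/
theorem lpProj_reproducing {n m : ℕ} {φ : ℝ → ℝ} (hφ : IsLittlewoodPaley φ)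
    {κ : 𝓢(EuclideanSpace ℝ (Fin n), ℂ)}
    (hκ : ∀ x, ∫ y, (κ (x - y)).re * lpKernel φ 0 y = lpKernel φ 0 x) (j : ℤ)
    {f : EuclideanSpace ℝ (Fin n) → EuclideanSpace ℝ (Fin m)} (hf : IsTemperedFun f)
    (x : EuclideanSpace ℝ (Fin n)) :
    Integrable (fun y => dyadicDilation j (fun x => (κ x).re) (x - y) • lpProj φ j f y) ∧
    lpProj φ j f x =
      ∫ y, dyadicDilation j (fun x => (κ x).re) (x - y) • lpProj φ j f y := by
  have hi := integrable_reproducing hφ κ j hf x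
  have e : ∀ y, ∫ z, dyadicDilation j (fun x => (κ x).re) (x - y) • lpKernel φ j (y - z) • f z =
      dyadicDilation j (fun x => (κ x).re) (x - y) • lpProj φ j f y := fun y => by
    rw [integral_smul, lpProj]
  constructor
  · simpa only [e] using hi.integral_prod_left
  · simp_rw [← e]
    rw [integral_integral_swap hi, lpProj]
    refine integral_congr_ae (Eventually.of_forall fun z => ?_)
    simp only [smul_smul]
    rw [integral_smul_const]
    congr 1
    rw [lpKernel_eq_dyadicDilation φ j, ← integral_dyadicDilation_mul (κ := fun x => (κ x).re) hκ j (x - z),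
      ← integral_sub_right_eq_self _ z]
    simp

theorem stronglyMeasurable_lpProj_uncurry {α : Type*} [MeasurableSpace α] {n m : ℕ} {φ : ℝ → ℝ}
    (hφ : IsLittlewoodPaley φ) (j : ℤ)
    {f : α → EuclideanSpace ℝ (Fin n) → EuclideanSpace ℝ (Fin m)}
    (hf : StronglyMeasurable (Function.uncurry f)) :
    StronglyMeasurable (Function.uncurry fun t x => lpProj φ j (f t) x) := by
  unfold lpProj
  refine StronglyMeasurable.integral_prod_right' (f := fun z : (α × EuclideanSpace ℝ (Fin n)) ×
    EuclideanSpace ℝ (Fin n) => lpKernel φ j (z.1.2 - z.2) • f z.1.1 z.2) ?_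
  have m1 : StronglyMeasurable fun z : (α × EuclideanSpace ℝ (Fin n)) × EuclideanSpace ℝ (Fin n) =>
      lpKernel φ j (z.1.2 - z.2) :=
    (continuous_lpKernel hφ j).stronglyMeasurable.comp_measurable
      ((measurable_snd.comp measurable_fst).sub measurable_snd)
  have m2 : StronglyMeasurable fun z : (α × EuclideanSpace ℝ (Fin n)) × EuclideanSpace ℝ (Fin n) =>
      f z.1.1 z.2 :=
    hf.comp_measurable ((measurable_fst.comp measurable_fst).prodMk measurable_snd)
  exact m1.smul m2

theorem stronglyMeasurable_lpProj {n m : ℕ} {φ : ℝ → ℝ} (hφ : IsLittlewoodPaley φ) (j : ℤ)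
    {f : EuclideanSpace ℝ (Fin n) → EuclideanSpace ℝ (Fin m)} (hf : StronglyMeasurable f) :
    StronglyMeasurable (lpProj φ j f) := by
  have h : StronglyMeasurable (Function.uncurry fun (_ : Unit) x => f x) :=
    hf.comp_measurable measurable_snd
  exact (stronglyMeasurable_lpProj_uncurry hφ j h).comp_measurable
    (g := fun x : EuclideanSpace ℝ (Fin n) => ((), x)) (by fun_prop)

/-- Differences of `P_j f` are controlled at scales below `2^{-j}`. -/
theorem exists_enorm_lpProj_sub_le {n : ℕ} {φ : ℝ → ℝ} (hφ : IsLittlewoodPaley φ) :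
    ∃ C : ℝ, 0 ≤ C ∧ ∀ (m : ℕ) (f : EuclideanSpace ℝ (Fin n) → EuclideanSpace ℝ (Fin m)),
      IsTemperedFun f → ∀ (j : ℤ) (x z : EuclideanSpace ℝ (Fin n)),
      ‖lpProj φ j f z - lpProj φ j f x‖ₑ ≤
        ENNReal.ofReal (C * ((2 : ℝ) ^ j * ‖z - x‖ * (1 + (2 : ℝ) ^ j * ‖z - x‖) ^ (n + 1))) *
          smoothing j (fun y => ‖lpProj φ j f y‖ₑ) x := by
  obtain ⟨κ, hκ⟩ := exists_reproducing_kernel (n := n) hφ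
  obtain ⟨C, h0, hC⟩ := κ.exists_abs_dyadicDilation_sub_le
  refine ⟨C, h0, fun m f hf j x z => ?_⟩
  obtain ⟨ix, ex⟩ := lpProj_reproducing hφ hκ j hf x
  obtain ⟨iz, ez⟩ := lpProj_reproducing hφ hκ j hf z
  rw [ex, ez, ← integral_sub iz ix, smoothing,
    ← lintegral_const_mul' _ _ ENNReal.ofReal_ne_top]
  refine (enorm_integral_le_lintegral_enorm _).trans (lintegral_mono fun y => ?_)
  rw [← sub_smul, enorm_smul, ← mul_assoc, ← ENNReal.ofReal_mul (by positivity)]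
  gcongr
  rw [Real.enorm_eq_ofReal_abs]
  refine ENNReal.ofReal_le_ofReal ?_
  simpa using hC j (x - y) (z - y)

/-! ### Recovering increments of `u` from its Littlewood-Paley pieces -/

/-- A locally integrable function which annihilates all test functions of integral zero is
constant. -/
theorem ae_eq_const_of_integral_contDiff_smul_eq_zero {n : ℕ} {F : Type*} [NormedAddCommGroup F]
    [NormedSpace ℝ F] [CompleteSpace F] {f : EuclideanSpace ℝ (Fin n) → F}
    (hf : LocallyIntegrable f volume)
    (h : ∀ ψ : EuclideanSpace ℝ (Fin n) → ℝ, ContDiff ℝ ∞ ψ → HasCompactSupport ψ →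
      ∫ x, ψ x = 0 → ∫ x, ψ x • f x = 0) :
    ∃ c, ∀ᵐ x, f x = c := by
  let b : ContDiffBump (0 : EuclideanSpace ℝ (Fin n)) := ⟨1, 2, by norm_num, by norm_num⟩
  set ψ₀ := b.normed volume with hψ₀
  have hc₀ : HasCompactSupport ψ₀ := b.hasCompactSupport_normed
  have hd₀ : ContDiff ℝ ∞ ψ₀ := b.contDiff_normed
  have hi₀ : Integrable ψ₀ := hd₀.continuous.integrable_of_hasCompactSupport hc₀
  refine ⟨∫ x, ψ₀ x • f x, ?_⟩
  set c := ∫ x, ψ₀ x • f x with hc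
  have key := ae_eq_zero_of_integral_contDiff_smul_eq_zero
    (hf.sub (locallyIntegrable_const c)) (fun g hg hgc => ?_)
  · filter_upwards [key] with x hx
    simpa [sub_eq_zero] using hx
  have hgi : Integrable g := hg.continuous.integrable_of_hasCompactSupport hgc
  have hgf : Integrable fun x => g x • f x :=
    hf.integrable_smul_left_of_hasCompactSupport hg.continuous hgc
  have h0f : Integrable fun x => ψ₀ x • f x :=
    hf.integrable_smul_left_of_hasCompactSupport hd₀.continuous hc₀
  -- Subtracting a multiple of the normalized bump makes an arbitrary test function admissible.
  have h1 := h (fun x => g x - (∫ y, g y) * ψ₀ x) (hg.sub (contDiff_const.mul hd₀))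
    (hgc.sub (hc₀.mul_left (f := fun _ => ∫ y, g y))) (by
      rw [integral_sub hgi (hi₀.const_mul _), integral_const_mul, b.integral_normed]
      simp)
  simp only [sub_smul, mul_smul] at h1
  rw [integral_sub hgf (g := fun x => (∫ y, g y) • ψ₀ x • f x) (h0f.smul (∫ y, g y)),
    integral_smul, ← hc] at h1
  simp only [Pi.sub_apply, smul_sub]
  rw [integral_sub hgf (hgi.smul_const c), integral_smul_const]
  exact h1

theorem locallyIntegrable_of_lintegral_ball {n : ℕ} {F : Type*} [NormedAddCommGroup F]
    {f : EuclideanSpace ℝ (Fin n) → F} (hf : AEStronglyMeasurable f volume)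
    (h : ∀ R : ℝ, ∫⁻ x in Metric.ball 0 R, ‖f x‖ₑ < ⊤) : LocallyIntegrable f volume := by
  intro x
  refine ⟨Metric.ball 0 (‖x‖ + 1), Metric.isOpen_ball.mem_nhds (by simp), hf.restrict, ?_⟩
  exact h _

/-- The bump is bounded below on every ball, so finiteness of the smoothing at one point gives local
integrability. -/
theorem lintegral_ball_lt_top_of_smoothing {n : ℕ} {H : EuclideanSpace ℝ (Fin n) → ℝ≥0∞}
    {x₀ : EuclideanSpace ℝ (Fin n)} (h : smoothing 0 H x₀ < ⊤) (R : ℝ) :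
    ∫⁻ x in Metric.ball 0 R, H x < ⊤ := by
  by_cases hR : R ≤ 0
  · simp [Metric.ball_eq_empty.2 hR]
  push Not at hR
  have hc : 0 < ((1 + (‖x₀‖ + R)) ^ (n + 1))⁻¹ := by positivity
  have hle : ENNReal.ofReal ((1 + (‖x₀‖ + R)) ^ (n + 1))⁻¹ * ∫⁻ x in Metric.ball 0 R, H x ≤
      smoothing 0 H x₀ := by
    rw [← lintegral_const_mul' _ _ ENNReal.ofReal_ne_top]
    refine le_trans ?_ (setLIntegral_le_lintegral (Metric.ball 0 R) _)
    refine setLIntegral_mono' Metric.isOpen_ball.measurableSet fun y hy => ?_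
    gcongr
    rw [mem_ball_zero_iff] at hy
    have : ‖x₀ - y‖ ≤ ‖x₀‖ + R := (norm_sub_le _ _).trans (by linarith)
    simp only [dyadicBump, zpow_zero, one_pow, one_mul]
    gcongr
  by_contra hcon
  rw [not_lt, top_le_iff] at hcon
  rw [hcon, ENNReal.mul_top (by simpa using hc)] at hle
  exact absurd h (not_lt.2 hle)

theorem IsTemperedFun.locallyIntegrable {n m : ℕ}
    {f : EuclideanSpace ℝ (Fin n) → EuclideanSpace ℝ (Fin m)} (hf : IsTemperedFun f) :
    LocallyIntegrable f volume := by
  obtain ⟨N, hN⟩ := hf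
  have hc : Continuous fun x : EuclideanSpace ℝ (Fin n) => (1 + ‖x‖) ^ (N : ℝ) :=
    Continuous.rpow_const (by fun_prop) fun x => Or.inl (by positivity)
  have h1 : LocallyIntegrable (fun x => (1 + ‖x‖) ^ (N : ℝ) • (1 + ‖x‖) ^ (-(N : ℝ)) • f x) volume :=
    hN.locallyIntegrable.continuous_smul hc
  convert! h1 using 2 with x
  rw [smul_smul, ← Real.rpow_add (by positivity)]
  simp

/-- The weights `min 1 2^l` which sum low and high frequencies. -/
noncomputable def frequencyWeight (l : ℤ) : ℝ≥0∞ := ENNReal.ofReal (min 1 ((2 : ℝ) ^ l))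

theorem frequencyWeight_of_nonneg {l : ℤ} (h : 0 ≤ l) : frequencyWeight l = 1 := by
  rw [frequencyWeight, min_eq_left (one_le_zpow₀ one_le_two h), ENNReal.ofReal_one]

theorem frequencyWeight_of_nonpos {l : ℤ} (h : l ≤ 0) :
    frequencyWeight l = ENNReal.ofReal ((2 : ℝ) ^ l) := by
  rw [frequencyWeight, min_eq_right (zpow_le_one_of_nonpos₀ one_le_two h)]

/-- Moving the reference frequency from `j` to `0` costs only a finite factor, which is enough to
transfer finiteness of the weighted sum. -/
theorem frequencyWeight_le (l j : ℤ) :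
    frequencyWeight l ≤ ENNReal.ofReal (max 1 ((2 : ℝ) ^ j)) * frequencyWeight (l - j) := by
  rw [frequencyWeight, frequencyWeight, ← ENNReal.ofReal_mul (by positivity)]
  refine ENNReal.ofReal_le_ofReal ?_
  have hj : (0 : ℝ) < 2 ^ j := by positivity
  rcases le_total 1 ((2 : ℝ) ^ (l - j)) with h | h
  · rw [min_eq_left h, mul_one]
    exact (min_le_left _ _).trans (le_max_left _ _)
  · rw [min_eq_right h]
    refine (min_le_right _ _).trans ?_
    calc (2 : ℝ) ^ l = 2 ^ j * 2 ^ (l - j) := by rw [← zpow_add₀ two_ne_zero]; congr 1; ring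
      _ ≤ _ := by gcongr; exact le_max_right _ _

theorem ae_lt_top_of_eLpNorm_mul_lt_top {α : Type*} [MeasurableSpace α] {ν : Measure α}
    {W f : α → ℝ≥0∞} (hW : AEMeasurable W ν) (hf : AEMeasurable f ν) (hW0 : ∀ᵐ x ∂ν, W x ≠ 0)
    {q : ℝ≥0∞} (hq : 1 ≤ q) (h : eLpNorm (fun x => W x * f x) q ν < ⊤) :
    ∀ᵐ x ∂ν, f x < ⊤ := by
  have q0 : q ≠ 0 := (zero_lt_one.trans_le hq).ne'
  have h1 : ∀ᵐ x ∂ν, W x * f x < ⊤ := by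
    by_cases hqt : q = ⊤
    · subst hqt
      have : ∀ᵐ x ∂ν, W x * f x ≤ eLpNorm (fun x => W x * f x) ⊤ ν := by
        simpa [eLpNorm_exponent_top, eLpNormEssSup] using
          ENNReal.ae_le_essSup fun x => W x * f x
      exact this.mono fun x hx => hx.trans_lt h
    · have hpos := ENNReal.toReal_pos q0 hqt
      have h2 := (eLpNorm_lt_top_iff_lintegral_rpow_enorm_lt_top q0 hqt).1 h
      have h3 := ae_lt_top' (by simpa using (hW.mul hf).pow_const _) h2.ne
      filter_upwards [h3] with x hx
      simpa [ENNReal.rpow_lt_top_iff_of_pos hpos] using hx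
  filter_upwards [h1, hW0] with x hx hx0
  by_contra hcon
  rw [not_lt, top_le_iff] at hcon
  rw [hcon, ENNReal.mul_top hx0] at hx
  exact lt_irrefl _ hx

theorem measurable_enorm_lpProj {n m : ℕ} {φ : ℝ → ℝ} (hφ : IsLittlewoodPaley φ) (j : ℤ)
    {f : EuclideanSpace ℝ (Fin n) → EuclideanSpace ℝ (Fin m)} (hf : StronglyMeasurable f) :
    Measurable fun x => ‖lpProj φ j f x‖ₑ :=
  (stronglyMeasurable_lpProj hφ j hf).enorm

theorem tendsto_Icc_neg_natCast_atTop :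
    Tendsto (fun N : ℕ => Finset.Icc (-(N : ℤ)) (N : ℤ)) atTop atTop := by
  refine tendsto_atTop_finset_of_monotone (fun a b h => ?_) fun x => ⟨x.natAbs, ?_⟩
  · exact Finset.Icc_subset_Icc (by simpa using h) (by simpa using h)
  · rw [Finset.mem_Icc]; omega

/-- If the increments of the Littlewood-Paley pieces are summable with locally integrable sum, then
the decomposition holds almost everywhere, up to a constant. -/
theorem HasLPDecomposition.exists_ae_eq_tsum {n m : ℕ} {φ : ℝ → ℝ} (hφ : IsLittlewoodPaley φ)
    {u : EuclideanSpace ℝ (Fin n) → EuclideanSpace ℝ (Fin m)} (hu : StronglyMeasurable u)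
    (hut : IsTemperedFun u) (hdec : HasLPDecomposition φ u) (x₀ : EuclideanSpace ℝ (Fin n))
    (hfin : ∀ R : ℝ, ∫⁻ z in Metric.ball 0 R, ∑' l : ℤ,
      ‖lpProj φ l u z - lpProj φ l u x₀‖ₑ < ⊤) :
    ∃ c, ∀ᵐ z, (∑' l : ℤ, ‖lpProj φ l u z - lpProj φ l u x₀‖ₑ < ⊤) ∧
      u z = c + ∑' l : ℤ, (lpProj φ l u z - lpProj φ l u x₀) := by
  set d : ℤ → EuclideanSpace ℝ (Fin n) → EuclideanSpace ℝ (Fin m) :=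
    fun l z => lpProj φ l u z - lpProj φ l u x₀ with hd
  have hdm : ∀ l, StronglyMeasurable (d l) := fun l =>
    (stronglyMeasurable_lpProj hφ l hu).sub stronglyMeasurable_const
  set D : EuclideanSpace ℝ (Fin n) → ℝ≥0∞ := fun z => ∑' l, ‖d l z‖ₑ with hD
  have hDm : Measurable D := Measurable.tsum fun l => (hdm l).enorm
  have hDfin : ∀ᵐ z, D z < ⊤ := by
    have h1 : ∀ N : ℕ, ∀ᵐ z, z ∈ Metric.ball (0 : EuclideanSpace ℝ (Fin n)) N → D z < ⊤ := by
      intro N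
      rw [← ae_restrict_iff' Metric.isOpen_ball.measurableSet]
      exact ae_lt_top hDm (hfin N).ne
    rw [← ae_all_iff] at h1
    filter_upwards [h1] with z hz
    obtain ⟨N, hN⟩ := exists_nat_gt ‖z‖
    exact hz N (by simpa using hN)
  have hDloc : LocallyIntegrable (fun z => (D z).toReal) volume := by
    refine locallyIntegrable_of_lintegral_ball hDm.ennreal_toReal.aestronglyMeasurable fun R => ?_
    refine lt_of_le_of_lt (lintegral_mono fun z => ?_) (hfin R)
    rw [Real.enorm_of_nonneg ENNReal.toReal_nonneg]
    exact ENNReal.ofReal_toReal_le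
  have hsum : ∀ᵐ z, Summable fun l => d l z := by
    filter_upwards [hDfin] with z hz
    exact Summable.of_enorm hz.ne
  set V : EuclideanSpace ℝ (Fin n) → EuclideanSpace ℝ (Fin m) := fun z => ∑' l, d l z with hV
  set S : ℕ → EuclideanSpace ℝ (Fin n) → EuclideanSpace ℝ (Fin m) :=
    fun N z => ∑ l ∈ Finset.Icc (-(N : ℤ)) (N : ℤ), d l z with hS
  have hSm : ∀ N, StronglyMeasurable (S N) := fun N =>
    Finset.stronglyMeasurable_fun_sum _ fun l _ => hdm l
  have hSV : ∀ᵐ z, Tendsto (fun N => S N z) atTop (𝓝 (V z)) := by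
    filter_upwards [hsum] with z hz
    exact hz.hasSum.comp tendsto_Icc_neg_natCast_atTop
  have hSD : ∀ N, ∀ᵐ z, ‖S N z‖ ≤ (D z).toReal := by
    intro N
    filter_upwards [hDfin] with z hz
    have : ‖S N z‖ₑ ≤ D z := (enorm_sum_le _ _).trans (ENNReal.sum_le_tsum _)
    simpa using ENNReal.toReal_mono hz.ne this
  have hVm : AEStronglyMeasurable V volume :=
    aestronglyMeasurable_of_tendsto_ae atTop (fun N => (hSm N).aestronglyMeasurable) hSV
  have hVD : ∀ᵐ z, ‖V z‖ ≤ (D z).toReal := by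
    filter_upwards [hSV, ae_all_iff.2 hSD] with z h1 h2
    exact le_of_tendsto h1.norm (Eventually.of_forall h2)
  have hVloc : LocallyIntegrable V volume :=
    hDloc.mono hVm (hVD.mono fun z hz => hz.trans (le_abs_self _))
  have hSloc : ∀ N, LocallyIntegrable (S N) volume := fun N =>
    hDloc.mono (hSm N).aestronglyMeasurable ((hSD N).mono fun z hz => hz.trans (le_abs_self _))
  -- Against `ψ` of integral zero, the partial sums of `P_l u` and those of the increments `d l`
  -- have the same integrals. The former tend to `∫ ψ u` by hypothesis, the latter to `∫ ψ V` by
  -- dominated convergence with majorant `D`.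
  have hconst : ∃ c, ∀ᵐ x, (u - V) x = c := by
    refine ae_eq_const_of_integral_contDiff_smul_eq_zero (hut.locallyIntegrable.sub hVloc)
      fun ψ hψ hψc hψ0 => ?_
    have hψi : Integrable ψ := hψ.continuous.integrable_of_hasCompactSupport hψc
    have lim1 := hdec (hψc.toSchwartzMap hψ) hψ0
    have lim2 : Tendsto (fun N => ∫ z, ψ z • S N z) atTop (𝓝 (∫ z, ψ z • V z)) := by
      refine tendsto_integral_of_dominated_convergence (fun z => |ψ z| * (D z).toReal)
        (fun N => (hψ.continuous.aestronglyMeasurable.smul (hSm N).aestronglyMeasurable)) ?_ ?_ ?_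
      · exact hDloc.integrable_smul_left_of_hasCompactSupport hψ.continuous.abs hψc.abs
      · intro N
        filter_upwards [hSD N] with z hz
        rw [norm_smul, Real.norm_eq_abs]
        gcongr
      · filter_upwards [hSV] with z hz
        exact hz.const_smul _
    have e : ∀ N : ℕ, ∫ z, (hψc.toSchwartzMap hψ) z •
        ∑ l ∈ Finset.Icc (-(N : ℤ)) (N : ℤ), lpProj φ l u z = ∫ z, ψ z • S N z := by
      intro N
      have h1 : ∀ z, (hψc.toSchwartzMap hψ) z •
          ∑ l ∈ Finset.Icc (-(N : ℤ)) (N : ℤ), lpProj φ l u z = ψ z • S N z +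
            ψ z • ∑ l ∈ Finset.Icc (-(N : ℤ)) (N : ℤ), lpProj φ l u x₀ := by
        intro z
        rw [← smul_add]
        simp [hS, hd]
      simp_rw [h1]
      rw [integral_add ((hSloc N).integrable_smul_left_of_hasCompactSupport hψ.continuous hψc)
        (hψi.smul_const _), integral_smul_const, hψ0]
      simp
    simp_rw [e] at lim1
    have huniq := tendsto_nhds_unique lim1 lim2
    simp only [Pi.sub_apply, smul_sub]
    rw [integral_sub (hut.locallyIntegrable.integrable_smul_left_of_hasCompactSupport
      hψ.continuous hψc) (hVloc.integrable_smul_left_of_hasCompactSupport hψ.continuous hψc)]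
    rw [← huniq]
    simp
  obtain ⟨c, hc⟩ := hconst
  refine ⟨c, ?_⟩
  filter_upwards [hDfin, hc] with z h1 h2
  refine ⟨h1, ?_⟩
  rw [← h2]
  exact (sub_add_cancel _ _).symm

/-- Increments of `u` are controlled by the increments of its Littlewood-Paley pieces, provided
that `u` has finite inhomogeneous norm. -/
theorem HasLPDecomposition.ae_enorm_sub_le {n m : ℕ} {φ : ℝ → ℝ} (hφ : IsLittlewoodPaley φ)
    {u : EuclideanSpace ℝ (Fin n) → EuclideanSpace ℝ (Fin m)} (hu : StronglyMeasurable u)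
    (hut : IsTemperedFun u) (hdec : HasLPDecomposition φ u)
    {W : EuclideanSpace ℝ (Fin n) → ℝ≥0∞} (hW : AEMeasurable W volume) (hW0 : ∀ᵐ x, W x ≠ 0)
    {q : ℝ≥0∞} (hq : 1 ≤ q) (hWq : SmoothingBounded W q)
    (hfin : ∑' l, frequencyWeight l *
      eLpNorm (fun x => W x * ‖lpProj φ l u x‖ₑ) q volume < ⊤) :
    ∀ᵐ x, ∀ᵐ z, ‖u z - u x‖ₑ ≤ ∑' l : ℤ, ‖lpProj φ l u z - lpProj φ l u x‖ₑ := by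
  obtain ⟨C, hC⟩ := hWq
  obtain ⟨B, hB0, hB⟩ := exists_enorm_lpProj_sub_le (n := n) hφ
  set a : ℤ → EuclideanSpace ℝ (Fin n) → ℝ≥0∞ := fun l x => ‖lpProj φ l u x‖ₑ with ha
  have ham : ∀ l, Measurable (a l) := fun l => measurable_enorm_lpProj hφ l hu
  -- One majorant for all increments: the pieces themselves for high frequencies, their smoothings
  -- with the gain `2^l` for low ones.
  set H : EuclideanSpace ℝ (Fin n) → ℝ≥0∞ :=
    fun x => ∑' l, frequencyWeight l * (a l x + smoothing l (a l) x) with hH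
  have hHm : Measurable H := Measurable.tsum fun l =>
    ((ham l).add (measurable_smoothing l (ham l))).const_mul _
  have hHn : eLpNorm (fun x => W x * H x) q volume < ⊤ := by
    have hWa : ∀ l, AEMeasurable (fun x => W x * a l x) volume := fun l =>
      hW.mul (ham l).aemeasurable
    have hWs : ∀ l, AEMeasurable (fun x => W x * smoothing l (a l) x) volume := fun l =>
      hW.mul (measurable_smoothing l (ham l)).aemeasurable
    calc eLpNorm (fun x => W x * H x) q volume
        = eLpNorm (fun x => ∑' l, frequencyWeight l *
            (W x * a l x + W x * smoothing l (a l) x)) q volume := by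
          congr 1
          ext x
          rw [hH, ← ENNReal.tsum_mul_left]
          refine tsum_congr fun l => ?_
          ring
      _ ≤ ∑' l, frequencyWeight l * ((1 + C) * eLpNorm (fun x => W x * a l x) q volume) := by
          refine (eLpNorm_ennreal_tsum_le (fun l => ((hWa l).add (hWs l)).const_mul _) hq).trans ?_
          refine ENNReal.tsum_le_tsum fun l => ?_
          refine (eLpNorm_ennreal_const_mul ((hWa l).add (hWs l)) _ hq).trans ?_
          refine mul_le_mul' le_rfl ?_
          refine (eLpNorm_ennreal_add_le (hWa l) (hWs l) hq).trans ?_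
          rw [add_mul, one_mul]
          exact add_le_add le_rfl (hC l (a l) (ham l))
      _ = (1 + C) * ∑' l, frequencyWeight l * eLpNorm (fun x => W x * a l x) q volume := by
          rw [← ENNReal.tsum_mul_left]
          exact tsum_congr fun l => mul_left_comm _ _ _
      _ < ⊤ := ENNReal.mul_lt_top (by simp) hfin
  have hHfin : ∀ᵐ x, H x < ⊤ := ae_lt_top_of_eLpNorm_mul_lt_top hW hHm.aemeasurable hW0 hq hHn
  have hHs : ∀ᵐ x, smoothing 0 H x < ⊤ :=
    ae_lt_top_of_eLpNorm_mul_lt_top hW (measurable_smoothing 0 hHm).aemeasurable hW0 hq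
      ((hC 0 H hHm).trans_lt (ENNReal.mul_lt_top (by simp) hHn))
  -- At the base point, `H` must be finite to bound the increments, and `smoothing 0 H` must be
  -- finite to make `H` locally integrable.
  obtain ⟨x₀, hx₀, hx₀'⟩ := (hHfin.and hHs).exists
  have hloc := lintegral_ball_lt_top_of_smoothing hx₀'
  have hbound : ∀ (R : ℝ) (z : EuclideanSpace ℝ (Fin n)), z ∈ Metric.ball 0 R →
      ∑' l : ℤ, ‖lpProj φ l u z - lpProj φ l u x₀‖ₑ ≤
        H z + H x₀ + ENNReal.ofReal (B * ((R + ‖x₀‖) * (1 + (R + ‖x₀‖)) ^ (n + 1))) * H x₀ := by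
    intro R z hz
    rw [mem_ball_zero_iff] at hz
    have hzx : ‖z - x₀‖ ≤ R + ‖x₀‖ := (norm_sub_le _ _).trans (by linarith)
    simp only [hH]
    rw [← ENNReal.tsum_mul_left, ← ENNReal.tsum_add, ← ENNReal.tsum_add]
    refine ENNReal.tsum_le_tsum fun l => ?_
    -- High frequencies use the triangle inequality; low ones use the smoothness of `P_l u`, where
    -- `2^l ≤ 1` lets the distance be bounded by `R + ‖x₀‖`.
    rcases le_total 0 l with hl | hl
    · rw [frequencyWeight_of_nonneg hl, one_mul, one_mul]
      refine enorm_sub_le.trans ?_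
      refine le_trans ?_ le_self_add
      exact add_le_add le_self_add le_self_add
    · refine le_trans ?_ le_add_self
      refine (hB m u hut l x₀ z).trans ?_
      have hR : 0 ≤ R + ‖x₀‖ := (norm_nonneg _).trans hzx
      generalize R + ‖x₀‖ = ρ at hR hzx ⊢
      rw [frequencyWeight_of_nonpos hl, ← mul_assoc (ENNReal.ofReal _) (ENNReal.ofReal _),
        ← ENNReal.ofReal_mul (by positivity)]
      refine mul_le_mul' (ENNReal.ofReal_le_ofReal ?_) le_add_self
      have h2 : (2 : ℝ) ^ l ≤ 1 := zpow_le_one_of_nonpos₀ one_le_two hl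
      have h3 : (2 : ℝ) ^ l * ‖z - x₀‖ ≤ ρ := by
        have := norm_nonneg (z - x₀)
        have : (0 : ℝ) < 2 ^ l := by positivity
        nlinarith
      calc B * ((2 : ℝ) ^ l * ‖z - x₀‖ * (1 + (2 : ℝ) ^ l * ‖z - x₀‖) ^ (n + 1))
          ≤ B * ((2 : ℝ) ^ l * ρ * (1 + ρ) ^ (n + 1)) := by gcongr
        _ = _ := by ring
  obtain ⟨c, hc⟩ := hdec.exists_ae_eq_tsum hφ hu hut x₀ fun R => by
    refine (setLIntegral_mono' Metric.isOpen_ball.measurableSet (hbound R)).trans_lt ?_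
    rw [lintegral_add_right _ measurable_const, lintegral_add_right _ measurable_const]
    refine ENNReal.add_lt_top.2 ⟨ENNReal.add_lt_top.2 ⟨hloc R, ?_⟩, ?_⟩
    · rw [setLIntegral_const]
      exact ENNReal.mul_lt_top hx₀ measure_ball_lt_top
    · rw [setLIntegral_const]
      exact ENNReal.mul_lt_top (ENNReal.mul_lt_top ENNReal.ofReal_lt_top hx₀) measure_ball_lt_top
  filter_upwards [hc] with x hx
  filter_upwards [hc] with z hz
  have sx : Summable fun l => lpProj φ l u x - lpProj φ l u x₀ := Summable.of_enorm hx.1.ne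
  have sz : Summable fun l => lpProj φ l u z - lpProj φ l u x₀ := Summable.of_enorm hz.1.ne
  rw [hx.2, hz.2, add_sub_add_left_eq_sub, ← sz.tsum_sub sx]
  simpa using enorm_tsum_le_tsum_enorm (f := fun l =>
    (lpProj φ l u z - lpProj φ l u x₀) - (lpProj φ l u x - lpProj φ l u x₀))

/-! ### The fixed-time estimate -/

theorem exists_smoothing_one_le (n : ℕ) : ∃ C : ℝ≥0, ∀ (j : ℤ) (x : EuclideanSpace ℝ (Fin n)),
    ∫⁻ y, ENNReal.ofReal (dyadicBump j (x - y)) ≤ C := by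
  refine ⟨2 ^ (n + 2) * 2 ^ n, fun j x => ?_⟩
  have h := smoothing_le_tsum_ballAverage j (f := fun _ => 1) measurable_const x
  simp only [smoothing, mul_one] at h
  refine h.trans ?_
  have hb : ∀ r : ℝ, 0 < r → ballAverage r (fun _ => 1) x ≤ 2 ^ n := by
    intro r hr
    rw [ballAverage, setLIntegral_const, one_mul]
    refine (mul_le_mul' le_rfl ((measure_mono (ball_subset_cube x r)).trans_eq
      (volume_cube _ _))).trans_eq ?_
    rw [← ENNReal.ofReal_pow (by positivity), ← ENNReal.ofReal_mul (by positivity),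
      Real.rpow_neg hr.le, Real.rpow_natCast, mul_pow, mul_left_comm,
      inv_mul_cancel₀ (by positivity), mul_one, ENNReal.ofReal_pow (by norm_num)]
    simp
  calc _ ≤ ∑' m : ℕ, ENNReal.ofReal (2 ^ (n + 1) * 2⁻¹ ^ m) * 2 ^ n :=
        ENNReal.tsum_le_tsum fun m => mul_le_mul' le_rfl (hb _ (by positivity))
    _ = _ := by
        rw [ENNReal.tsum_mul_right, tsum_ofReal_geometric]
        push_cast
        rfl

/-- `K_j` is dominated by `dyadicBump j`, with a gain when multiplied by a lower frequency
increment. -/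
theorem exists_abs_lpKernel_mul_le {n : ℕ} {φ : ℝ → ℝ} (hφ : IsLittlewoodPaley φ) :
    ∃ C : ℝ, 0 ≤ C ∧ ∀ (j : ℤ) (x : EuclideanSpace ℝ (Fin n)),
      |lpKernel φ j x| ≤ C * dyadicBump j x ∧
      ∀ i ≤ j, |lpKernel φ j x| * ((2 : ℝ) ^ i * ‖x‖ * (1 + (2 : ℝ) ^ i * ‖x‖) ^ (n + 1)) ≤
        C * (2 : ℝ) ^ (i - j) * dyadicBump j x := by
  -- `n + 2` powers of decay pay for the increment factor, and `n + 1` are left for the bump.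
  obtain ⟨C, h0, hC⟩ := exists_abs_lpKernel_le (n := n) hφ ((n + 1) + (n + 2))
  refine ⟨C, h0, fun j x => ?_⟩
  have hj : (0 : ℝ) < 2 ^ j := by positivity
  have h1 : 1 ≤ 1 + (2 : ℝ) ^ j * ‖x‖ := by
    have : 0 ≤ (2 : ℝ) ^ j * ‖x‖ := by positivity
    linarith
  constructor
  · refine (hC j x).trans ?_
    rw [dyadicBump]
    gcongr _ * (_ * (?_)⁻¹)
    exact pow_le_pow_right₀ h1 (by omega)
  · intro i hi
    have hle : (2 : ℝ) ^ i * ‖x‖ * (1 + (2 : ℝ) ^ i * ‖x‖) ^ (n + 1) ≤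
        (2 : ℝ) ^ (i - j) * (1 + (2 : ℝ) ^ j * ‖x‖) ^ (n + 2) := by
      have e : (2 : ℝ) ^ i * ‖x‖ = (2 : ℝ) ^ (i - j) * ((2 : ℝ) ^ j * ‖x‖) := by
        rw [← mul_assoc, ← zpow_add₀ two_ne_zero]
        congr 2
        ring
      have h2 : (2 : ℝ) ^ i ≤ 2 ^ j := zpow_le_zpow_right₀ one_le_two hi
      calc (2 : ℝ) ^ i * ‖x‖ * (1 + (2 : ℝ) ^ i * ‖x‖) ^ (n + 1)
          ≤ (2 : ℝ) ^ (i - j) * (1 + (2 : ℝ) ^ j * ‖x‖) * (1 + (2 : ℝ) ^ j * ‖x‖) ^ (n + 1) := by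
            rw [e]
            gcongr ?_ * ?_
            · gcongr; linarith
            · rw [← e]; gcongr
        _ = _ := by ring
    refine (mul_le_mul (hC j x) hle (by positivity) (by positivity)).trans_eq ?_
    rw [dyadicBump, pow_add _ (n + 1) (n + 2), mul_inv]
    have : (1 + (2 : ℝ) ^ j * ‖x‖) ^ (n + 2) ≠ 0 := by positivity
    field_simp

/-- Weights for which the fixed-time estimate holds. -/
structure WeightTriple {n : ℕ} (W₁ W₂ : EuclideanSpace ℝ (Fin n) → ℝ≥0∞) (q q₁ q₂ : ℝ≥0∞) :
    Prop where
  aemeasurable_left : AEMeasurable W₁ volume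
  aemeasurable_right : AEMeasurable W₂ volume
  ne_zero_left : ∀ᵐ x, W₁ x ≠ 0
  one_le : 1 ≤ q
  one_le_left : 1 ≤ q₁
  one_le_right : 1 ≤ q₂
  holder : 1 / q = 1 / q₁ + 1 / q₂
  bounded_left : SmoothingBounded W₁ q₁
  bounded_right : SmoothingBounded W₂ q₂
  bounded_mul : SmoothingBounded (fun x => W₁ x * W₂ x) q

namespace WeightTriple

variable {n : ℕ} {W₁ W₂ : EuclideanSpace ℝ (Fin n) → ℝ≥0∞} {q q₁ q₂ : ℝ≥0∞}

theorem eLpNorm_mul_le (h : WeightTriple W₁ W₂ q q₁ q₂) {a g : EuclideanSpace ℝ (Fin n) → ℝ≥0∞}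
    (ha : Measurable a) (hg : Measurable g) :
    eLpNorm (fun x => W₁ x * W₂ x * (a x * g x)) q volume ≤
      eLpNorm (fun x => W₁ x * a x) q₁ volume * eLpNorm (fun x => W₂ x * g x) q₂ volume := by
  refine le_trans (eLpNorm_ennreal_mono_ae (Eventually.of_forall fun x => ?_))
    (eLpNorm_ennreal_mul_le (h.aemeasurable_left.mul ha.aemeasurable)
      (h.aemeasurable_right.mul hg.aemeasurable) h.one_le h.one_le_left h.one_le_right h.holder)
  exact le_of_eq (mul_mul_mul_comm _ _ _ _)

/-- Serves the frequencies `i ≤ j`. The smoothing of the piece is taken at `x`, outside the integral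
in `z`, so Hölder separates the factors and each is bounded with its own weight. -/
theorem exists_low_le (h : WeightTriple W₁ W₂ q q₁ q₂) : ∃ C : ℝ≥0, ∀ (i j : ℤ)
    (a g : EuclideanSpace ℝ (Fin n) → ℝ≥0∞), Measurable a → Measurable g →
    eLpNorm (fun x => W₁ x * W₂ x * (smoothing i a x * (smoothing j g x + g x))) q volume ≤
      C * (eLpNorm (fun x => W₁ x * a x) q₁ volume *
        eLpNorm (fun x => W₂ x * g x) q₂ volume) := by
  obtain ⟨C₁, h₁⟩ := h.bounded_left
  obtain ⟨C₂, h₂⟩ := h.bounded_right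
  refine ⟨C₁ * (C₂ + 1), fun i j a g ha hg => ?_⟩
  have hsg := measurable_smoothing j hg
  refine (h.eLpNorm_mul_le (measurable_smoothing i ha) (hsg.add hg)).trans ?_
  have h3 : eLpNorm (fun x => W₂ x * (smoothing j g x + g x)) q₂ volume ≤
      (C₂ + 1) * eLpNorm (fun x => W₂ x * g x) q₂ volume := by
    simp only [mul_add]
    refine (eLpNorm_ennreal_add_le (h.aemeasurable_right.mul hsg.aemeasurable)
      (h.aemeasurable_right.mul hg.aemeasurable) h.one_le_right).trans ?_
    rw [add_mul, one_mul]
    exact add_le_add (h₂ j g hg) le_rfl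
  refine (mul_le_mul' (h₁ i a ha) h3).trans_eq ?_
  push_cast
  ring

/-- Serves the frequencies `i > j`. The four terms come from expanding `(g(x) + g(z)) (a(z) +
a(x))`. In `a(z) g(z)` the product itself is averaged, and this is where the condition on `w₁ w₂`
enters. -/
theorem exists_high_le (h : WeightTriple W₁ W₂ q q₁ q₂) : ∃ C : ℝ≥0, ∀ (j : ℤ)
    (a g : EuclideanSpace ℝ (Fin n) → ℝ≥0∞), Measurable a → Measurable g →
    eLpNorm (fun x => W₁ x * W₂ x * (smoothing j a x * g x + smoothing j (fun y => a y * g y) x +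
      (a x * smoothing j g x + a x * g x))) q volume ≤
      C * (eLpNorm (fun x => W₁ x * a x) q₁ volume *
        eLpNorm (fun x => W₂ x * g x) q₂ volume) := by
  obtain ⟨C₁, h₁⟩ := h.bounded_left
  obtain ⟨C₂, h₂⟩ := h.bounded_right
  obtain ⟨C₃, h₃⟩ := h.bounded_mul
  refine ⟨C₁ + C₃ + (C₂ + 1), fun j a g ha hg => ?_⟩
  have hsa := measurable_smoothing j ha
  have hsg := measurable_smoothing j hg
  have hsag := measurable_smoothing j (ha.mul hg)
  have hW : AEMeasurable (fun x => W₁ x * W₂ x) volume :=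
    h.aemeasurable_left.mul h.aemeasurable_right
  simp only [mul_add]
  have m1 : AEMeasurable (fun x => W₁ x * W₂ x * (smoothing j a x * g x)) volume :=
    hW.mul (hsa.mul hg).aemeasurable
  have m2 : AEMeasurable (fun x => W₁ x * W₂ x * smoothing j (fun y => a y * g y) x) volume :=
    hW.mul hsag.aemeasurable
  have m3 : AEMeasurable (fun x => W₁ x * W₂ x * (a x * smoothing j g x)) volume :=
    hW.mul (ha.mul hsg).aemeasurable
  have m4 : AEMeasurable (fun x => W₁ x * W₂ x * (a x * g x)) volume :=
    hW.mul (ha.mul hg).aemeasurable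
  refine (eLpNorm_ennreal_add_le (m1.add m2) (m3.add m4) h.one_le).trans ?_
  refine (add_le_add (eLpNorm_ennreal_add_le m1 m2 h.one_le)
    (eLpNorm_ennreal_add_le m3 m4 h.one_le)).trans ?_
  have e1 := (h.eLpNorm_mul_le hsa hg).trans (mul_le_mul' (h₁ j a ha) le_rfl)
  have e2 := (h₃ j _ (ha.mul hg)).trans (mul_le_mul' le_rfl (h.eLpNorm_mul_le ha hg))
  have e3 := (h.eLpNorm_mul_le ha hsg).trans (mul_le_mul' le_rfl (h₂ j g hg))
  have e4 := h.eLpNorm_mul_le ha hg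
  refine (add_le_add (add_le_add e1 e2) (add_le_add e3 e4)).trans_eq ?_
  push_cast
  ring

end WeightTriple

theorem integrable_lpKernel {n : ℕ} {φ : ℝ → ℝ} (hφ : IsLittlewoodPaley φ) (j : ℤ) :
    Integrable (lpKernel φ j : EuclideanSpace ℝ (Fin n) → ℝ) := by
  obtain ⟨C, h0, hC⟩ := exists_abs_lpKernel_le_unscaled (n := n) hφ j (n + 1)
  have := integrable_one_add_norm (E := EuclideanSpace ℝ (Fin n)) (μ := volume)
      (r := ((n + 1 : ℕ) : ℝ)) (by simp)
  refine (this.const_mul C).mono' (continuous_lpKernel hφ j).aestronglyMeasurable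
    (Eventually.of_forall fun x => ?_)
  rw [Real.rpow_neg (by positivity), Real.rpow_natCast]
  exact hC x

/-- `P_j` annihilates constants, hence only depends on increments. -/
theorem enorm_lpProj_le {n m : ℕ} {φ : ℝ → ℝ} (hφ : IsLittlewoodPaley φ) (j : ℤ)
    (f : EuclideanSpace ℝ (Fin n) → EuclideanSpace ℝ (Fin m)) (x : EuclideanSpace ℝ (Fin n)) :
    ‖lpProj φ j f x‖ₑ ≤ ∫⁻ z, ‖lpKernel φ j (x - z)‖ₑ * ‖f z - f x‖ₑ := by
  rw [lpProj]
  by_cases hi : Integrable fun z => lpKernel φ j (x - z) • f z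
  · have hk : Integrable fun z => lpKernel φ j (x - z) := (integrable_lpKernel hφ j).comp_sub_left x
    have h0 : ∫ z, lpKernel φ j (x - z) • f x = 0 := by
      rw [integral_smul_const, integral_sub_left_eq_self, integral_lpKernel hφ, zero_smul]
    have h1 : ∫ z, lpKernel φ j (x - z) • f z = ∫ z, lpKernel φ j (x - z) • (f z - f x) := by
      simp_rw [smul_sub]
      rw [integral_sub hi (hk.smul_const _), h0, sub_zero]
    rw [h1]
    refine (enorm_integral_le_lintegral_enorm _).trans_eq ?_
    simp_rw [enorm_smul]
  -- Without integrability the Bochner integral is `0` by convention, and the bound is trivial.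
  · rw [integral_undef hi]
    simp

/-- The contribution of one Littlewood-Paley piece of `u` to `P_j F(u)`. -/
theorem exists_lintegral_lpKernel_mul_le {n : ℕ} {φ : ℝ → ℝ} (hφ : IsLittlewoodPaley φ) :
    ∃ C : ℝ≥0, ∀ (m : ℕ) (u : EuclideanSpace ℝ (Fin n) → EuclideanSpace ℝ (Fin m))
      (g : EuclideanSpace ℝ (Fin n) → ℝ≥0∞), StronglyMeasurable u → IsTemperedFun u →
      Measurable g → ∀ (i j : ℤ) (x : EuclideanSpace ℝ (Fin n)),
      (i ≤ j → ∫⁻ z, ‖lpKernel φ j (x - z)‖ₑ *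
          ((g x + g z) * ‖lpProj φ i u z - lpProj φ i u x‖ₑ) ≤
        C * ENNReal.ofReal ((2 : ℝ) ^ (i - j)) *
          (smoothing i (fun y => ‖lpProj φ i u y‖ₑ) x * (smoothing j g x + g x))) ∧
      ∫⁻ z, ‖lpKernel φ j (x - z)‖ₑ * ((g x + g z) * ‖lpProj φ i u z - lpProj φ i u x‖ₑ) ≤
        C * (smoothing j (fun y => ‖lpProj φ i u y‖ₑ) x * g x +
          smoothing j (fun y => ‖lpProj φ i u y‖ₑ * g y) x +
          (‖lpProj φ i u x‖ₑ * smoothing j g x + ‖lpProj φ i u x‖ₑ * g x)) := by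
  obtain ⟨A, hA⟩ := exists_smoothing_one_le n
  obtain ⟨B, hB0, hB⟩ := exists_enorm_lpProj_sub_le (n := n) hφ
  obtain ⟨D, hD0, hD⟩ := exists_abs_lpKernel_mul_le (n := n) hφ
  refine ⟨(A + 1) * (B.toNNReal + 1) * D.toNNReal, fun m u g hu hut hg i j x => ?_⟩
  have hbm : Measurable fun z : EuclideanSpace ℝ (Fin n) =>
      ENNReal.ofReal (dyadicBump j (x - z)) :=
    ((continuous_dyadicBump j).comp (continuous_const.sub continuous_id)).measurable.ennreal_ofReal
  have ham := measurable_enorm_lpProj hφ i hu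
  have hA1 : (1 : ℝ≥0∞) ≤ A + 1 := le_add_self
  have hB1 : (1 : ℝ≥0∞) ≤ B.toNNReal + 1 := le_add_self
  set a : EuclideanSpace ℝ (Fin n) → ℝ≥0∞ := fun y => ‖lpProj φ i u y‖ₑ with ha
  constructor
  · intro hij
    calc ∫⁻ z, ‖lpKernel φ j (x - z)‖ₑ *
          ((g x + g z) * ‖lpProj φ i u z - lpProj φ i u x‖ₑ)
        ≤ ∫⁻ z, (B.toNNReal * D.toNNReal * ENNReal.ofReal ((2 : ℝ) ^ (i - j)) *
            smoothing i a x) * (ENNReal.ofReal (dyadicBump j (x - z)) * g x +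
              ENNReal.ofReal (dyadicBump j (x - z)) * g z) := by
          refine lintegral_mono fun z => ?_
          have h1 : ‖lpKernel φ j (x - z)‖ₑ * ENNReal.ofReal (B * ((2 : ℝ) ^ i * ‖z - x‖ *
              (1 + (2 : ℝ) ^ i * ‖z - x‖) ^ (n + 1))) ≤
              B.toNNReal * D.toNNReal * ENNReal.ofReal ((2 : ℝ) ^ (i - j)) *
                ENNReal.ofReal (dyadicBump j (x - z)) := by
            rw [Real.enorm_eq_ofReal_abs, ← ENNReal.ofReal_mul (abs_nonneg _)]
            change _ ≤ ENNReal.ofReal B * ENNReal.ofReal D * _ * _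
            rw [← ENNReal.ofReal_mul hB0, ← ENNReal.ofReal_mul (by positivity),
              ← ENNReal.ofReal_mul (by positivity)]
            refine ENNReal.ofReal_le_ofReal ?_
            have := mul_le_mul_of_nonneg_left ((hD j (x - z)).2 i hij) hB0
            rw [norm_sub_rev z x]
            linarith
          calc _ ≤ ‖lpKernel φ j (x - z)‖ₑ * ((g x + g z) * (ENNReal.ofReal (B * ((2 : ℝ) ^ i *
                ‖z - x‖ * (1 + (2 : ℝ) ^ i * ‖z - x‖) ^ (n + 1))) * smoothing i a x)) := by
                gcongr
                exact hB m u hut i x z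
            _ = (‖lpKernel φ j (x - z)‖ₑ * ENNReal.ofReal (B * ((2 : ℝ) ^ i * ‖z - x‖ *
                (1 + (2 : ℝ) ^ i * ‖z - x‖) ^ (n + 1)))) * (smoothing i a x * (g x + g z)) := by
                ring
            _ ≤ (B.toNNReal * D.toNNReal * ENNReal.ofReal ((2 : ℝ) ^ (i - j)) *
                ENNReal.ofReal (dyadicBump j (x - z))) * (smoothing i a x * (g x + g z)) :=
                mul_le_mul' h1 le_rfl
            _ = _ := by ring
      _ ≤ (B.toNNReal * D.toNNReal * ENNReal.ofReal ((2 : ℝ) ^ (i - j)) *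
            smoothing i a x) * (A * g x + smoothing j g x) := by
          have m1 : Measurable fun z => ENNReal.ofReal (dyadicBump j (x - z)) * g x :=
            hbm.mul_const _
          have m2 : Measurable fun z => ENNReal.ofReal (dyadicBump j (x - z)) * g z := hbm.mul hg
          rw [lintegral_const_mul _ (m1.fun_add m2), lintegral_add_left m1,
            lintegral_mul_const _ hbm]
          exact mul_le_mul' le_rfl (add_le_add (mul_le_mul' (hA j x) le_rfl) le_rfl)
      _ ≤ ((B.toNNReal + 1) * D.toNNReal * ENNReal.ofReal ((2 : ℝ) ^ (i - j)) *
            smoothing i a x) * ((A + 1) * g x + (A + 1) * smoothing j g x) := by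
          gcongr
          · exact le_self_add
          · exact le_self_add
          · exact le_mul_of_one_le_left' hA1
      _ = _ := by
          push_cast
          ring
  · calc ∫⁻ z, ‖lpKernel φ j (x - z)‖ₑ *
          ((g x + g z) * ‖lpProj φ i u z - lpProj φ i u x‖ₑ)
        ≤ ∫⁻ z, D.toNNReal * ((ENNReal.ofReal (dyadicBump j (x - z)) * a z * g x +
            ENNReal.ofReal (dyadicBump j (x - z)) * (a z * g z)) +
            (a x * (ENNReal.ofReal (dyadicBump j (x - z)) * g z) +
              ENNReal.ofReal (dyadicBump j (x - z)) * (a x * g x))) := by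
          refine lintegral_mono fun z => ?_
          have h1 : ‖lpKernel φ j (x - z)‖ₑ ≤
              D.toNNReal * ENNReal.ofReal (dyadicBump j (x - z)) := by
            rw [Real.enorm_eq_ofReal_abs]
            change _ ≤ ENNReal.ofReal D * _
            rw [← ENNReal.ofReal_mul hD0]
            exact ENNReal.ofReal_le_ofReal (hD j (x - z)).1
          refine (mul_le_mul' h1 (mul_le_mul' le_rfl enorm_sub_le)).trans_eq ?_
          simp only [ha]
          ring
      _ ≤ D.toNNReal * ((smoothing j a x * g x + smoothing j (fun y => a y * g y) x) +
            (a x * smoothing j g x + A * (a x * g x))) := by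
          have m0 : Measurable fun z => ENNReal.ofReal (dyadicBump j (x - z)) * a z := hbm.mul ham
          have m1 : Measurable fun z => ENNReal.ofReal (dyadicBump j (x - z)) * a z * g x :=
            m0.mul_const _
          have m2 : Measurable fun z => ENNReal.ofReal (dyadicBump j (x - z)) * (a z * g z) :=
            hbm.mul (ham.mul hg)
          have m3 : Measurable fun z => ENNReal.ofReal (dyadicBump j (x - z)) * g z := hbm.mul hg
          have m4 : Measurable fun z => a x * (ENNReal.ofReal (dyadicBump j (x - z)) * g z) :=
            m3.const_mul _
          have m5 : Measurable fun z => ENNReal.ofReal (dyadicBump j (x - z)) * (a x * g x) :=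
            hbm.mul_const _
          rw [lintegral_const_mul _ ((m1.fun_add m2).fun_add (m4.fun_add m5)),
            lintegral_add_left (m1.fun_add m2), lintegral_add_left m1, lintegral_add_left m4,
            lintegral_mul_const _ m0, lintegral_const_mul _ m3, lintegral_mul_const _ hbm]
          refine mul_le_mul' le_rfl (add_le_add le_rfl (add_le_add le_rfl ?_))
          exact mul_le_mul' (hA j x) le_rfl
      _ ≤ D.toNNReal * (((A + 1) * (smoothing j a x * g x) +
            (A + 1) * smoothing j (fun y => a y * g y) x) +
            ((A + 1) * (a x * smoothing j g x) + (A + 1) * (a x * g x))) := by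
          refine mul_le_mul' le_rfl (add_le_add (add_le_add (le_mul_of_one_le_left' hA1)
            (le_mul_of_one_le_left' hA1)) (add_le_add (le_mul_of_one_le_left' hA1)
              (mul_le_mul' le_self_add le_rfl)))
      _ = (A + 1) * 1 * D.toNNReal * (smoothing j a x * g x + smoothing j (fun y => a y * g y) x +
            (a x * smoothing j g x + a x * g x)) := by ring
      _ ≤ (A + 1) * (B.toNNReal + 1) * D.toNNReal * (smoothing j a x * g x +
            smoothing j (fun y => a y * g y) x + (a x * smoothing j g x + a x * g x)) := by
          gcongr
      _ = _ := by push_cast; rfl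
/-- The fixed-time estimate. -/
theorem WeightTriple.exists_eLpNorm_lpProj_comp_le {n : ℕ} {φ : ℝ → ℝ} (hφ : IsLittlewoodPaley φ)
    {W₁ W₂ : EuclideanSpace ℝ (Fin n) → ℝ≥0∞} {q q₁ q₂ : ℝ≥0∞}
    (h : WeightTriple W₁ W₂ q q₁ q₂) :
    ∃ C : ℝ≥0, ∀ (k l : ℕ) (u : EuclideanSpace ℝ (Fin n) → EuclideanSpace ℝ (Fin k))
      (F : EuclideanSpace ℝ (Fin k) → EuclideanSpace ℝ (Fin l))
      (g : EuclideanSpace ℝ (Fin n) → ℝ≥0∞) (M : ℝ≥0), M ≠ 0 → StronglyMeasurable u →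
      IsTemperedFun u → HasLPDecomposition φ u → Measurable g →
      (∀ x z, ‖F (u z) - F (u x)‖ₑ ≤ M * ((g x + g z) * ‖u z - u x‖ₑ)) →
      eLpNorm (fun x => W₂ x * g x) q₂ volume ≠ 0 → ∀ j : ℤ,
      eLpNorm (fun x => W₁ x * W₂ x * ‖lpProj φ j (fun y => F (u y)) x‖ₑ) q volume ≤
        C * M * (∑' i, frequencyWeight (i - j) *
          eLpNorm (fun x => W₁ x * ‖lpProj φ i u x‖ₑ) q₁ volume) *
          eLpNorm (fun x => W₂ x * g x) q₂ volume := by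
  obtain ⟨A, hA⟩ := exists_lintegral_lpKernel_mul_le (n := n) hφ
  obtain ⟨C₁, h₁⟩ := h.exists_low_le
  obtain ⟨C₂, h₂⟩ := h.exists_high_le
  -- The `+ 1` keeps the constant nonzero, so that an infinite frequency sum really makes the
  -- right-hand side `⊤`.
  refine ⟨A * (C₁ + C₂) + 1, fun k l u F g M hM hu hut hdec hg hF hγ j => ?_⟩
  set a : ℤ → EuclideanSpace ℝ (Fin n) → ℝ≥0∞ := fun i x => ‖lpProj φ i u x‖ₑ with ha
  have ham : ∀ i, Measurable (a i) := fun i => measurable_enorm_lpProj hφ i hu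
  set α : ℤ → ℝ≥0∞ := fun i => eLpNorm (fun x => W₁ x * a i x) q₁ volume with hα
  set γ := eLpNorm (fun x => W₂ x * g x) q₂ volume with hγdef
  by_cases hfin : ∑' i, frequencyWeight (i - j) * α i = ⊤
  · refine le_of_le_of_eq le_top (Eq.symm ?_)
    change _ * (∑' i, frequencyWeight (i - j) * α i) * γ = ⊤
    rw [hfin, ENNReal.mul_top, ENNReal.top_mul hγ]
    simp [hM]
  have hfin0 : ∑' i, frequencyWeight i * α i < ⊤ := by
    refine lt_of_le_of_lt (ENNReal.tsum_le_tsum fun i =>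
      mul_le_mul' (frequencyWeight_le i j) le_rfl) ?_
    simp_rw [mul_assoc]
    rw [ENNReal.tsum_mul_left]
    exact ENNReal.mul_lt_top ENNReal.ofReal_lt_top (lt_top_iff_ne_top.2 hfin)
  have hae := hdec.ae_enorm_sub_le hφ hu hut h.aemeasurable_left h.ne_zero_left h.one_le_left
    h.bounded_left hfin0
  set low : ℤ → EuclideanSpace ℝ (Fin n) → ℝ≥0∞ := fun i x =>
    smoothing i (a i) x * (smoothing j g x + g x) with hlow
  set high : ℤ → EuclideanSpace ℝ (Fin n) → ℝ≥0∞ := fun i x =>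
    smoothing j (a i) x * g x + smoothing j (fun y => a i y * g y) x +
      (a i x * smoothing j g x + a i x * g x) with hhigh
  have hlowm : ∀ i, Measurable (low i) := fun i =>
    (measurable_smoothing i (ham i)).mul ((measurable_smoothing j hg).add hg)
  have hhighm : ∀ i, Measurable (high i) := fun i =>
    (((measurable_smoothing j (ham i)).mul hg).add (measurable_smoothing j ((ham i).mul hg))).add
      (((ham i).mul (measurable_smoothing j hg)).add ((ham i).mul hg))
  -- The factor is `2^{i-j}` for `i ≤ j` and `1` otherwise, matching the gain available in each
  -- regime.
  set T : ℤ → EuclideanSpace ℝ (Fin n) → ℝ≥0∞ := fun i x =>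
    frequencyWeight (i - j) * if i ≤ j then low i x else high i x with hT
  have hTm : ∀ i, Measurable (T i) := by
    intro i
    refine Measurable.const_mul ?_ _
    by_cases hij : i ≤ j
    · simpa only [hij, if_true] using hlowm i
    · simpa only [hij, if_false] using hhighm i
  have hpt : ∀ᵐ x, ‖lpProj φ j (fun y => F (u y)) x‖ₑ ≤ M * A * ∑' i, T i x := by
    filter_upwards [hae] with x hx
    have hkm : Measurable fun z => ‖lpKernel φ j (x - z)‖ₑ :=
      ((continuous_lpKernel hφ j).comp (continuous_const.sub continuous_id)).measurable.enorm
    have hdm : ∀ i, Measurable fun z => ‖lpProj φ i u z - lpProj φ i u x‖ₑ := fun i =>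
      ((stronglyMeasurable_lpProj hφ i hu).sub stronglyMeasurable_const).enorm
    have him : ∀ i, Measurable fun z => ‖lpKernel φ j (x - z)‖ₑ *
        ((g x + g z) * ‖lpProj φ i u z - lpProj φ i u x‖ₑ) := fun i =>
      hkm.mul ((hg.const_add _).mul (hdm i))
    calc ‖lpProj φ j (fun y => F (u y)) x‖ₑ
        ≤ ∫⁻ z, ‖lpKernel φ j (x - z)‖ₑ * ‖F (u z) - F (u x)‖ₑ := enorm_lpProj_le hφ j _ x
      _ ≤ ∫⁻ z, M * ∑' i, ‖lpKernel φ j (x - z)‖ₑ *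
            ((g x + g z) * ‖lpProj φ i u z - lpProj φ i u x‖ₑ) := by
          refine lintegral_mono_ae ?_
          filter_upwards [hx] with z hz
          rw [ENNReal.tsum_mul_left, ENNReal.tsum_mul_left, mul_left_comm]
          refine mul_le_mul' le_rfl ((hF x z).trans ?_)
          gcongr
      _ = M * ∑' i, ∫⁻ z, ‖lpKernel φ j (x - z)‖ₑ *
            ((g x + g z) * ‖lpProj φ i u z - lpProj φ i u x‖ₑ) := by
          rw [lintegral_const_mul _ (Measurable.tsum him),
            lintegral_tsum fun i => (him i).aemeasurable]
      _ ≤ M * ∑' i, A * T i x := by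
          refine mul_le_mul' le_rfl (ENNReal.tsum_le_tsum fun i => ?_)
          obtain ⟨hl, hh⟩ := hA k u g hu hut hg i j x
          by_cases hij : i ≤ j
          · simp only [hT, hij, if_true]
            rw [frequencyWeight_of_nonpos (by omega), ← mul_assoc]
            exact hl hij
          · simp only [hT, hij, if_false]
            rw [frequencyWeight_of_nonneg (by omega), one_mul]
            exact hh
      _ = M * A * ∑' i, T i x := by rw [ENNReal.tsum_mul_left, mul_assoc]
  have hTn : ∀ i, eLpNorm (fun x => W₁ x * W₂ x * T i x) q volume ≤
      (C₁ + C₂) * (frequencyWeight (i - j) * (α i * γ)) := by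
    intro i
    have hWm : AEMeasurable (fun x => W₁ x * W₂ x) volume :=
      h.aemeasurable_left.mul h.aemeasurable_right
    simp only [hT, mul_left_comm _ (frequencyWeight (i - j))]
    by_cases hij : i ≤ j
    · simp only [hij, if_true]
      refine (eLpNorm_ennreal_const_mul (hWm.mul (hlowm i).aemeasurable) _ h.one_le).trans ?_
      refine mul_le_mul' le_rfl ((h₁ i j (a i) g (ham i) hg).trans ?_)
      exact mul_le_mul' le_self_add le_rfl
    · simp only [hij, if_false]
      refine (eLpNorm_ennreal_const_mul (hWm.mul (hhighm i).aemeasurable) _ h.one_le).trans ?_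
      refine mul_le_mul' le_rfl ((h₂ j (a i) g (ham i) hg).trans ?_)
      exact mul_le_mul' le_add_self le_rfl
  have hWT : ∀ i, AEMeasurable (fun x => W₁ x * W₂ x * T i x) volume := fun i =>
    (h.aemeasurable_left.mul h.aemeasurable_right).mul (hTm i).aemeasurable
  calc eLpNorm (fun x => W₁ x * W₂ x * ‖lpProj φ j (fun y => F (u y)) x‖ₑ) q volume
      ≤ eLpNorm (fun x => (M * A) * ∑' i, W₁ x * W₂ x * T i x) q volume := by
        refine eLpNorm_ennreal_mono_ae (hpt.mono fun x hx => ?_)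
        refine (mul_le_mul' le_rfl hx).trans_eq ?_
        rw [ENNReal.tsum_mul_left]
        ring
    _ ≤ (M * A) * ∑' i, (C₁ + C₂) * (frequencyWeight (i - j) * (α i * γ)) := by
        refine (eLpNorm_ennreal_const_mul (AEMeasurable.tsum hWT) _ h.one_le).trans ?_
        refine mul_le_mul' le_rfl ((eLpNorm_ennreal_tsum_le hWT h.one_le).trans ?_)
        exact ENNReal.tsum_le_tsum hTn
    _ = A * (C₁ + C₂) * M * (∑' i, frequencyWeight (i - j) * α i) * γ := by
        rw [ENNReal.tsum_mul_left]
        simp_rw [← mul_assoc (frequencyWeight _)]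
        rw [ENNReal.tsum_mul_right]
        ring
    _ ≤ _ := by
        push_cast
        gcongr
        exact le_self_add

/-- Fundamental theorem of calculus along the segment from `w` to `v`. The `+ 1` makes the constant
positive, as the fixed-time estimate requires. -/
theorem IsDominatedNonlinearity.enorm_sub_le {k l : ℕ} {μ : ℝ → ℝ}
    {F : EuclideanSpace ℝ (Fin k) → EuclideanSpace ℝ (Fin l)} {G : EuclideanSpace ℝ (Fin k) → ℝ}
    (h : IsDominatedNonlinearity μ F G) (hμ : IntegrableOn μ (Icc 0 1) volume)
    (v w : EuclideanSpace ℝ (Fin k)) :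
    ‖F v - F w‖ₑ ≤ (((∫ τ in Icc 0 1, μ τ).toNNReal + 1 : ℝ≥0) : ℝ≥0∞) *
      ((ENNReal.ofReal (G w) + ENNReal.ofReal (G v)) * ‖v - w‖ₑ) := by
  have hF : ∀ y, HasFDerivAt F (fderiv ℝ F y) y := fun y =>
    (h.contDiff.differentiable one_ne_zero y).hasFDerivAt
  set c : ℝ → EuclideanSpace ℝ (Fin k) := fun τ => τ • v + (1 - τ) • w with hc
  have hder : ∀ τ, HasDerivAt (fun τ => F (c τ)) (fderiv ℝ F (c τ) (v - w)) τ := by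
    intro τ
    have h1 : HasDerivAt c (v - w) τ := by
      have := ((hasDerivAt_id τ).smul_const v).add
        (((hasDerivAt_const τ (1 : ℝ)).sub (hasDerivAt_id τ)).smul_const w)
      convert! this using 1
      simp [sub_eq_add_neg]
    exact (hF (c τ)).comp_hasDerivAt τ h1
  have hcc : Continuous c := by fun_prop
  have hcont : Continuous fun τ => fderiv ℝ F (c τ) (v - w) :=
    ((h.contDiff.continuous_fderiv one_ne_zero).comp hcc).clm_apply continuous_const
  have hint : F v - F w = ∫ τ in (0 : ℝ)..1, fderiv ℝ F (c τ) (v - w) := by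
    rw [intervalIntegral.integral_eq_sub_of_hasDerivAt (fun τ _ => hder τ)
      (hcont.intervalIntegrable _ _)]
    simp [hc]
  have hG : 0 < G v + G w := add_pos (h.pos_G v) (h.pos_G w)
  have hnorm : ‖F v - F w‖ ≤ (∫ τ in Icc (0 : ℝ) 1, μ τ) * ((G w + G v) * ‖v - w‖) := by
    rw [hint, intervalIntegral.integral_of_le zero_le_one, ← integral_Icc_eq_integral_Ioc,
      ← integral_mul_const]
    refine norm_integral_le_of_norm_le (hμ.mul_const _) ?_
    filter_upwards [h.bound v w] with τ hτ
    refine (ContinuousLinearMap.le_opNorm _ _).trans ?_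
    rw [abs_of_pos hG] at hτ
    calc _ ≤ μ τ * (G v + G w) * ‖v - w‖ := mul_le_mul_of_nonneg_right hτ (norm_nonneg _)
      _ = _ := by ring
  have hv := (h.pos_G v).le
  have hw := (h.pos_G w).le
  rw [← ofReal_norm, ← ofReal_norm, ← ENNReal.ofReal_add hw hv,
    ← ENNReal.ofReal_mul (by positivity)]
  refine (ENNReal.ofReal_le_ofReal (hnorm.trans (mul_le_mul_of_nonneg_right
    (Real.le_coe_toNNReal _) (by positivity)))).trans ?_
  rw [ENNReal.ofReal_mul (NNReal.coe_nonneg _), ENNReal.ofReal_coe_nnreal]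
  gcongr
  exact le_self_add

/-! ### Summation over frequencies and integration in time -/

theorem eLpNorm_ennreal_const_mul_eq {α : Type*} [MeasurableSpace α] {ν : Measure α}
    {f : α → ℝ≥0∞} (hf : AEMeasurable f ν) {c : ℝ≥0∞} (hc0 : c ≠ 0) (hct : c ≠ ⊤) {p : ℝ≥0∞}
    (hp : 1 ≤ p) : eLpNorm (fun x => c * f x) p ν = c * eLpNorm f p ν := by
  refine le_antisymm (eLpNorm_ennreal_const_mul hf c hp) ?_
  have h1 : eLpNorm f p ν ≤ c⁻¹ * eLpNorm (fun x => c * f x) p ν := by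
    refine le_trans (le_of_eq ?_) (eLpNorm_ennreal_const_mul (hf.const_mul c) c⁻¹ hp)
    congr 1
    ext x
    rw [← mul_assoc, ENNReal.inv_mul_cancel hc0 hct, one_mul]
  calc c * eLpNorm f p ν ≤ c * (c⁻¹ * eLpNorm (fun x => c * f x) p ν) := mul_le_mul' le_rfl h1
    _ = _ := by rw [← mul_assoc, ENNReal.mul_inv_cancel hc0 hct, one_mul]

/-- The off-diagonal decay `2^{ms} min 1 2^{-m}` of the interaction of frequencies. -/
noncomputable def frequencyDecay (s : ℝ) (m : ℤ) : ℝ≥0∞ :=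
  ENNReal.ofReal ((2 : ℝ) ^ ((m : ℝ) * s)) * frequencyWeight (-m)

/-- The terms are `2^{-(1-s)m}` for `m ≥ 0` and `2^{-s|m|}` for `m ≤ 0`: convergence uses `s < 1` on
one side and `s > 0` on the other. -/
theorem tsum_frequencyDecay_ne_top {s : ℝ} (hs : s ∈ Ioo (0 : ℝ) 1) :
    ∑' m, frequencyDecay s m ≠ ⊤ := by
  have e : ∀ m, frequencyDecay s m =
      ENNReal.ofReal ((2 : ℝ) ^ ((m : ℝ) * s) * min 1 ((2 : ℝ) ^ (-m))) := fun m => by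
    rw [frequencyDecay, frequencyWeight, ENNReal.ofReal_mul (by positivity)]
  simp_rw [e]
  refine Summable.tsum_ofReal_ne_top (Summable.of_nat_of_neg ?_ ?_)
  · refine (summable_geometric_of_lt_one (r := (2 : ℝ) ^ (s - 1)) (by positivity)
      (Real.rpow_lt_one_of_one_lt_of_neg one_lt_two (by linarith [hs.2]))).congr fun m => ?_
    rw [min_eq_right (zpow_le_one_of_nonpos₀ one_le_two (by simp)), ← Real.rpow_natCast,
      ← Real.rpow_mul zero_le_two, ← Real.rpow_intCast, ← Real.rpow_add zero_lt_two]
    congr 1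
    push_cast
    ring
  · refine (summable_geometric_of_lt_one (r := (2 : ℝ) ^ (-s)) (by positivity)
      (Real.rpow_lt_one_of_one_lt_of_neg one_lt_two (by linarith [hs.1]))).congr fun m => ?_
    rw [min_eq_left (one_le_zpow₀ one_le_two (by simp)), ← Real.rpow_natCast,
      ← Real.rpow_mul zero_le_two, mul_one]
    congr 1
    push_cast
    ring

theorem frequencyWeight_mul_eq (s : ℝ) (i j : ℤ) :
    ENNReal.ofReal ((2 : ℝ) ^ ((j : ℝ) * s)) * frequencyWeight (i - j) =
      frequencyDecay s (j - i) * ENNReal.ofReal ((2 : ℝ) ^ ((i : ℝ) * s)) := by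
  rw [frequencyDecay, mul_right_comm, ← ENNReal.ofReal_mul (by positivity),
    ← Real.rpow_add zero_lt_two, neg_sub]
  congr 4
  push_cast
  ring

theorem lpProj_congr_ae {n m : ℕ} (φ : ℝ → ℝ) (j : ℤ)
    {f g : EuclideanSpace ℝ (Fin n) → EuclideanSpace ℝ (Fin m)} (h : f =ᵐ[volume] g) :
    lpProj φ j f = lpProj φ j g := by
  ext1 x
  rw [lpProj, lpProj]
  refine integral_congr_ae ?_
  filter_upwards [h] with y hy
  rw [hy]

theorem IsTemperedFun.congr_ae {n m : ℕ}
    {f g : EuclideanSpace ℝ (Fin n) → EuclideanSpace ℝ (Fin m)} (hf : IsTemperedFun f)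
    (h : f =ᵐ[volume] g) : IsTemperedFun g := by
  obtain ⟨N, hN⟩ := hf
  refine ⟨N, hN.congr ?_⟩
  filter_upwards [h] with y hy
  rw [hy]

theorem HasLPDecomposition.congr_ae {n m : ℕ} {φ : ℝ → ℝ}
    {f g : EuclideanSpace ℝ (Fin n) → EuclideanSpace ℝ (Fin m)} (hf : HasLPDecomposition φ f)
    (h : f =ᵐ[volume] g) : HasLPDecomposition φ g := by
  intro ψ hψ
  have h1 := hf ψ hψ
  simp_rw [lpProj_congr_ae φ _ h] at h1
  convert! h1 using 2
  refine integral_congr_ae ?_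
  filter_upwards [h] with y hy
  rw [hy]

/-- The norm of `w f` in `L^q`, written with extended nonnegative functions. -/
theorem eLpNorm_weight_smul_eq {n m : ℕ} {w : EuclideanSpace ℝ (Fin n) → ℝ} (hw : IsWeight w)
    {f : EuclideanSpace ℝ (Fin n) → EuclideanSpace ℝ (Fin m)} (hf : AEStronglyMeasurable f volume)
    {c : ℝ} (hc : 0 < c) {q : ℝ≥0∞} (hq : 1 ≤ q) :
    eLpNorm (fun x => (w x * c) • f x) q volume =
      ENNReal.ofReal c * eLpNorm (fun x => ENNReal.ofReal (w x) * ‖f x‖ₑ) q volume := by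
  have hm : AEMeasurable (fun x => ENNReal.ofReal (w x) * ‖f x‖ₑ) volume :=
    hw.1.ennreal_ofReal.mul hf.enorm
  rw [← eLpNorm_ennreal_const_mul_eq hm (by simpa using hc)
    ENNReal.ofReal_ne_top hq]
  refine eLpNorm_congr_enorm_ae ?_
  filter_upwards [hw.2] with x hx
  rw [enorm_smul, Real.enorm_of_nonneg (by positivity), ENNReal.ofReal_mul hx.le, enorm_eq_self]
  ring

theorem IsWeight.measurable_eLpNorm {α : Type*} [MeasurableSpace α] {n : ℕ}
    {w : EuclideanSpace ℝ (Fin n) → ℝ} (hw : IsWeight w)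
    {f : α → EuclideanSpace ℝ (Fin n) → ℝ≥0∞} (hf : Measurable (Function.uncurry f)) (q : ℝ≥0∞) :
    Measurable fun t => eLpNorm (fun x => ENNReal.ofReal (w x) * f t x) q volume := by
  obtain ⟨w', hw', hww'⟩ := hw.1
  have e : (fun t => eLpNorm (fun x => ENNReal.ofReal (w x) * f t x) q volume) =
      fun t => eLpNorm (fun x => ENNReal.ofReal (w' x) * f t x) q volume := by
    ext t
    refine eLpNorm_congr_ae ?_
    filter_upwards [hww'] with x hx
    rw [hx]
  rw [e]
  refine Measurable.eLpNorm_prod_right (f := fun t x => ENNReal.ofReal (w' x) * f t x) ?_ q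
  exact (hw'.comp measurable_snd).ennreal_ofReal.mul hf

theorem IsWeight.mul {n : ℕ} {w₁ w₂ : EuclideanSpace ℝ (Fin n) → ℝ} (h₁ : IsWeight w₁)
    (h₂ : IsWeight w₂) : IsWeight fun x => w₁ x * w₂ x := by
  refine ⟨h₁.1.mul h₂.1, ?_⟩
  filter_upwards [h₁.2, h₂.2] with x hx hx'
  positivity

/-- Parts (a) and (b) differ only in the reason why the smoothing operators are bounded, so both
follow from this common form. -/
theorem WeightTriple.exists_besovNorm_comp_le {n : ℕ} {φ : ℝ → ℝ} (hφ : IsLittlewoodPaley φ)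
    (k l : ℕ) {s : ℝ} (hs : s ∈ Ioo (0 : ℝ) 1) {r p p₁ p₂ : ℝ≥0∞} (hr : 1 ≤ r) (hp : 1 ≤ p)
    (hp₁ : 1 ≤ p₁) (hp₂ : 1 ≤ p₂) (hpp : 1 / p = 1 / p₁ + 1 / p₂)
    {w₁ w₂ : EuclideanSpace ℝ (Fin n) → ℝ} (hw₁ : IsWeight w₁) (hw₂ : IsWeight w₂)
    {q q₁ q₂ : ℝ≥0∞}
    (h : WeightTriple (fun x => ENNReal.ofReal (w₁ x)) (fun x => ENNReal.ofReal (w₂ x)) q q₁ q₂)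
    {μ : ℝ → ℝ} (hμ : IntegrableOn μ (Icc 0 1) volume) :
    ∃ C : ℝ≥0, ∀ (F : EuclideanSpace ℝ (Fin k) → EuclideanSpace ℝ (Fin l))
      (G : EuclideanSpace ℝ (Fin k) → ℝ), IsDominatedNonlinearity μ F G →
      ∀ (T : ℝ≥0∞) (u : ℝ → EuclideanSpace ℝ (Fin n) → EuclideanSpace ℝ (Fin k)),
        IsAdmissible φ F T u →
        besovNorm φ s r p q T (fun x => w₁ x * w₂ x) (fun t x => F (u t x)) ≤
          C * besovNorm φ s r p₁ q₁ T w₁ u *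
            mixedNorm p₂ q₂ T (fun t x => w₂ x * G (u t x)) := by
  obtain ⟨C, hC⟩ := h.exists_eLpNorm_lpProj_comp_le hφ
  set M : ℝ≥0 := (∫ τ in Icc 0 1, μ τ).toNNReal + 1 with hM
  have hM0 : M ≠ 0 := by positivity
  obtain ⟨D, hD⟩ : ∃ D : ℝ≥0, (D : ℝ≥0∞) = ∑' m, frequencyDecay s m :=
    ⟨_, ENNReal.coe_toNNReal (tsum_frequencyDecay_ne_top hs)⟩
  refine ⟨C * M * D, fun F G hFG T u hu => ?_⟩
  have hw := hw₁.mul hw₂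
  set ν := volume.restrict (timeInterval T) with hν
  have hFc : Continuous F := hFG.contDiff.continuous
  -- A jointly measurable representative of `u`; at almost every time it agrees with `u` almost
  -- everywhere in `x`, so all norms are unchanged.
  obtain ⟨v', hv', huv⟩ := hu.measurable
  set v : ℝ → EuclideanSpace ℝ (Fin n) → EuclideanSpace ℝ (Fin k) := fun t x => v' (t, x) with hv
  have hvm : StronglyMeasurable (Function.uncurry v) := hv'
  have hvt : ∀ t, StronglyMeasurable (v t) := fun t => hv'.comp_measurable measurable_prodMk_left
  have huv' : ∀ᵐ t ∂ν, u t =ᵐ[volume] v t := Measure.ae_ae_of_ae_prod huv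
  set c : ℤ → ℝ≥0∞ := fun j => ENNReal.ofReal ((2 : ℝ) ^ ((j : ℝ) * s)) with hc
  set a : ℤ → ℝ → ℝ≥0∞ := fun i t =>
    eLpNorm (fun x => ENNReal.ofReal (w₁ x) * ‖lpProj φ i (v t) x‖ₑ) q₁ volume with ha
  set b : ℤ → ℝ → ℝ≥0∞ := fun j t =>
    eLpNorm (fun x => ENNReal.ofReal (w₁ x) * ENNReal.ofReal (w₂ x) *
      ‖lpProj φ j (fun y => F (v t y)) x‖ₑ) q volume with hb
  set γ : ℝ → ℝ≥0∞ := fun t =>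
    eLpNorm (fun x => ENNReal.ofReal (w₂ x) * ENNReal.ofReal (G (v t x))) q₂ volume with hγ
  have ham : ∀ i, Measurable (a i) := fun i => hw₁.measurable_eLpNorm
    (stronglyMeasurable_lpProj_uncurry hφ i hvm).enorm q₁
  have hγm : Measurable γ := hw₂.measurable_eLpNorm
    (f := fun t x => ENNReal.ofReal (G (v t x)))
    (hFG.measurable_G.comp hvm.measurable).ennreal_ofReal q₂
  have e₁ : ∀ i : ℤ, mixedNorm p₁ q₁ T
      (fun t x => (w₁ x * (2 : ℝ) ^ ((i : ℝ) * s)) • lpProj φ i (u t) x) =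
        eLpNorm (fun t => c i * a i t) p₁ ν := by
    intro i
    refine eLpNorm_congr_ae ?_
    filter_upwards [huv'] with t ht
    rw [lpProj_congr_ae φ i ht]
    exact eLpNorm_weight_smul_eq hw₁ (stronglyMeasurable_lpProj hφ i (hvt t)).aestronglyMeasurable
      (by positivity) h.one_le_left
  have e₂ : mixedNorm p₂ q₂ T (fun t x => w₂ x * G (u t x)) = eLpNorm γ p₂ ν := by
    refine eLpNorm_congr_ae ?_
    filter_upwards [huv'] with t ht
    refine eLpNorm_congr_enorm_ae ?_
    filter_upwards [ht, hw₂.2] with x hx hx'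
    have := hFG.pos_G (v t x)
    rw [hx, Real.enorm_of_nonneg (by positivity), ENNReal.ofReal_mul hx'.le, enorm_eq_self]
  have e₃ : ∀ j : ℤ, mixedNorm p q T
      (fun t x => (w₁ x * w₂ x * (2 : ℝ) ^ ((j : ℝ) * s)) • lpProj φ j (fun y => F (u t y)) x) =
        eLpNorm (fun t => c j * b j t) p ν := by
    intro j
    refine eLpNorm_congr_ae ?_
    filter_upwards [huv'] with t ht
    rw [lpProj_congr_ae φ j (f := fun y => F (u t y)) (g := fun y => F (v t y))
      (ht.fun_comp F)]
    rw [eLpNorm_weight_smul_eq hw (stronglyMeasurable_lpProj hφ j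
      (hFc.comp_stronglyMeasurable (hvt t))).aestronglyMeasurable (by positivity) h.one_le]
    congr 1
    refine eLpNorm_congr_ae ?_
    filter_upwards [hw₁.2] with x hx
    rw [ENNReal.ofReal_mul hx.le]
  -- Positivity of `G` and of `w₂` excludes the product `⊤ * 0` on the right of the fixed-time
  -- estimate.
  have hγ0 : ∀ t, γ t ≠ 0 := by
    intro t ht
    have hm : AEMeasurable (fun x => ENNReal.ofReal (w₂ x) * ENNReal.ofReal (G (v t x))) volume :=
      hw₂.1.ennreal_ofReal.mul
        (hFG.measurable_G.comp (hvt t).measurable).ennreal_ofReal.aemeasurable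
    rw [hγ, eLpNorm_eq_zero_iff hm.aestronglyMeasurable
      (zero_lt_one.trans_le h.one_le_right).ne'] at ht
    obtain ⟨x, hx, hx'⟩ := (ht.and hw₂.2).exists
    have := hFG.pos_G (v t x)
    simp only [Pi.zero_apply, mul_eq_zero, ENNReal.ofReal_eq_zero] at hx
    rcases hx with hx | hx <;> linarith
  have hpt : ∀ j, ∀ᵐ t ∂ν, c j * b j t ≤
      (C * M) * ((∑' i, frequencyDecay s (j - i) * (c i * a i t)) * γ t) := by
    intro j
    filter_upwards [huv', hu.tempered, hu.decomposition] with t h1 h2 h3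
    have := hC k l (v t) F (fun x => ENNReal.ofReal (G (v t x))) M hM0 (hvt t) (h2.congr_ae h1)
      (h3.congr_ae h1) (hFG.measurable_G.comp (hvt t).measurable).ennreal_ofReal
      (fun x z => hFG.enorm_sub_le hμ (v t z) (v t x)) (hγ0 t) j
    calc c j * b j t ≤ c j * (C * M * (∑' i, frequencyWeight (i - j) * a i t) * γ t) :=
          mul_le_mul' le_rfl this
      _ = (C * M) * ((∑' i, c j * (frequencyWeight (i - j) * a i t)) * γ t) := by
          rw [ENNReal.tsum_mul_left]; ring
      _ = _ := by
          simp_rw [← mul_assoc, hc, frequencyWeight_mul_eq]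
  have hcam : ∀ i, Measurable fun t => c i * a i t := fun i => (ham i).const_mul _
  have hsm : ∀ j, Measurable fun t => ∑' i, frequencyDecay s (j - i) * (c i * a i t) := fun j =>
    Measurable.tsum fun i => (hcam i).const_mul _
  have hj : ∀ j, eLpNorm (fun t => c j * b j t) p ν ≤ (C * M * eLpNorm γ p₂ ν) *
      ∑' m, frequencyDecay s m * eLpNorm (fun t => c (j - m) * a (j - m) t) p₁ ν := by
    intro j
    calc eLpNorm (fun t => c j * b j t) p ν
        ≤ C * M * (eLpNorm (fun t => ∑' i, frequencyDecay s (j - i) * (c i * a i t)) p₁ ν *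
            eLpNorm γ p₂ ν) := by
          refine (eLpNorm_ennreal_mono_ae (hpt j)).trans ?_
          refine (eLpNorm_ennreal_const_mul ((hsm j).mul hγm).aemeasurable _ hp).trans ?_
          exact mul_le_mul' le_rfl (eLpNorm_ennreal_mul_le (hsm j).aemeasurable hγm.aemeasurable
            hp hp₁ hp₂ hpp)
      _ ≤ C * M * ((∑' i, frequencyDecay s (j - i) * eLpNorm (fun t => c i * a i t) p₁ ν) *
            eLpNorm γ p₂ ν) := by
          refine mul_le_mul' le_rfl (mul_le_mul' ?_ le_rfl)
          refine (eLpNorm_ennreal_tsum_le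
            (fun i => ((hcam i).const_mul _).aemeasurable) hp₁).trans ?_
          exact ENNReal.tsum_le_tsum fun i =>
            eLpNorm_ennreal_const_mul (hcam i).aemeasurable _ hp₁
      _ = _ := by
          -- The substitution `m = j - i` exhibits a convolution over `ℤ`, ready for Young's
          -- inequality.
          rw [← (Equiv.subLeft j).tsum_eq
            fun i => frequencyDecay s (j - i) * eLpNorm (fun t => c i * a i t) p₁ ν]
          simp only [Equiv.subLeft_apply, sub_sub_cancel]
          ring
  rw [besovNorm, besovNorm]
  simp only [e₁, e₂, e₃]
  refine (eLpNorm_ennreal_mono_ae (Eventually.of_forall hj)).trans ?_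
  refine (eLpNorm_ennreal_const_mul (measurable_of_countable _).aemeasurable _ hr).trans ?_
  refine (mul_le_mul' le_rfl (eLpNorm_int_convolution_le (frequencyDecay s)
    (fun i => eLpNorm (fun t => c i * a i t) p₁ ν) hr)).trans_eq ?_
  rw [← hD]
  push_cast
  ring

/-! ### The theorem for Muckenhoupt weights -/

theorem SmoothingBounded.congr_ae {n : ℕ} {W W' : EuclideanSpace ℝ (Fin n) → ℝ≥0∞} {q : ℝ≥0∞}
    (h : SmoothingBounded W q) (hW : W =ᵐ[volume] W') : SmoothingBounded W' q := by
  obtain ⟨C, hC⟩ := h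
  have e : ∀ f : EuclideanSpace ℝ (Fin n) → ℝ≥0∞,
      eLpNorm (fun x => W' x * f x) q volume = eLpNorm (fun x => W x * f x) q volume := fun f =>
    eLpNorm_congr_ae (by filter_upwards [hW] with x hx; rw [hx])
  exact ⟨C, fun j f hf => by rw [e, e]; exact hC j f hf⟩

theorem Muckenhoupt.smoothingBounded_mul {n : ℕ} {q : ℝ} (hq : 1 < q)
    {w₁ w₂ : EuclideanSpace ℝ (Fin n) → ℝ} (hw₁ : IsWeight w₁) (hw₂ : IsWeight w₂)
    (hA : Muckenhoupt q fun x => (w₁ x * w₂ x) ^ q) :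
    SmoothingBounded (fun x => ENNReal.ofReal (w₁ x) * ENNReal.ofReal (w₂ x))
      (ENNReal.ofReal q) := by
  refine (Muckenhoupt.smoothingBounded hq (hw₁.mul hw₂) hA).congr_ae ?_
  filter_upwards [hw₁.2] with x hx
  rw [ENNReal.ofReal_mul hx.le]

theorem theorem2p3 (n k l : ℕ) (hn : 1 ≤ n)
    (φ : ℝ → ℝ) (hφ : IsLittlewoodPaley φ)
    (s : ℝ) (hs : s ∈ Ioo (0 : ℝ) 1)
    (r : ℝ≥0∞) (hr : 1 ≤ r)
    (p p₁ p₂ : ℝ≥0∞) (hp : 1 ≤ p) (hp₁ : 1 ≤ p₁) (hp₂ : 1 ≤ p₂)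
    (hpp : 1 / p = 1 / p₁ + 1 / p₂)
    (q : ℝ) (hq : 1 < q)
    (w₁ w₂ : EuclideanSpace ℝ (Fin n) → ℝ) (hw₁ : IsWeight w₁) (hw₂ : IsWeight w₂)
    (hw : Muckenhoupt q fun x => (w₁ x * w₂ x) ^ q)
    (μ : ℝ → ℝ) (hμ : IntegrableOn μ (Icc 0 1) volume) :
    (∀ q₁ q₂ : ℝ, 1 < q₁ → 1 < q₂ → 1 / q = 1 / q₁ + 1 / q₂ →
      Muckenhoupt q₁ (fun x => w₁ x ^ q₁) → Muckenhoupt q₂ (fun x => w₂ x ^ q₂) →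
      ∃ C : ℝ≥0, ∀ (F : EuclideanSpace ℝ (Fin k) → EuclideanSpace ℝ (Fin l))
        (G : EuclideanSpace ℝ (Fin k) → ℝ), IsDominatedNonlinearity μ F G →
        ∀ (T : ℝ≥0∞) (u : ℝ → EuclideanSpace ℝ (Fin n) → EuclideanSpace ℝ (Fin k)),
          0 < T → IsAdmissible φ F T u →
          besovNorm φ s r p (ENNReal.ofReal q) T (fun x => w₁ x * w₂ x) (fun t x => F (u t x)) ≤
            C * besovNorm φ s r p₁ (ENNReal.ofReal q₁) T w₁ u *
              mixedNorm p₂ (ENNReal.ofReal q₂) T (fun t x => w₂ x * G (u t x))) ∧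
    (Muckenhoupt q (fun x => w₁ x ^ q) → MuckenhouptOne (fun x => (w₂ x)⁻¹) →
      ∃ C : ℝ≥0, ∀ (F : EuclideanSpace ℝ (Fin k) → EuclideanSpace ℝ (Fin l))
        (G : EuclideanSpace ℝ (Fin k) → ℝ), IsDominatedNonlinearity μ F G →
        ∀ (T : ℝ≥0∞) (u : ℝ → EuclideanSpace ℝ (Fin n) → EuclideanSpace ℝ (Fin k)),
          0 < T → IsAdmissible φ F T u →
          besovNorm φ s r p (ENNReal.ofReal q) T (fun x => w₁ x * w₂ x) (fun t x => F (u t x)) ≤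
            C * besovNorm φ s r p₁ (ENNReal.ofReal q) T w₁ u *
              mixedNorm p₂ ⊤ T (fun t x => w₂ x * G (u t x))) := by
  have hq1 : 1 ≤ ENNReal.ofReal q := by simpa using hq.le
  have hmul := Muckenhoupt.smoothingBounded_mul hq hw₁ hw₂ hw
  constructor
  · intro q₁ q₂ hq₁ hq₂ hqq hA₁ hA₂
    have hholder : 1 / ENNReal.ofReal q = 1 / ENNReal.ofReal q₁ + 1 / ENNReal.ofReal q₂ := by
      simp only [one_div] at hqq ⊢
      rw [← ENNReal.ofReal_inv_of_pos (by linarith), ← ENNReal.ofReal_inv_of_pos (by linarith),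
        ← ENNReal.ofReal_inv_of_pos (by linarith),
        ← ENNReal.ofReal_add (by positivity) (by positivity), hqq]
    obtain ⟨C, hC⟩ := WeightTriple.exists_besovNorm_comp_le hφ k l hs hr hp hp₁ hp₂ hpp hw₁ hw₂
      (q := ENNReal.ofReal q) (q₁ := ENNReal.ofReal q₁) (q₂ := ENNReal.ofReal q₂)
      ⟨hw₁.1.ennreal_ofReal, hw₂.1.ennreal_ofReal, hw₁.ofReal_ne, hq1, by simpa using hq₁.le,
        by simpa using hq₂.le, hholder, hA₁.smoothingBounded hq₁ hw₁,
        hA₂.smoothingBounded hq₂ hw₂, hmul⟩ hμ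
    exact ⟨C, fun F G hFG T u _ hu => hC F G hFG T u hu⟩
  · intro hA₁ hA₂
    -- The endpoint is the Hölder triple `(q, q, ∞)`, with `A_1` for `w₂⁻¹` supplying the `L^∞`
    -- bound.
    obtain ⟨C, hC⟩ := WeightTriple.exists_besovNorm_comp_le hφ k l hs hr hp hp₁ hp₂ hpp hw₁ hw₂
      (q := ENNReal.ofReal q) (q₁ := ENNReal.ofReal q) (q₂ := ⊤)
      ⟨hw₁.1.ennreal_ofReal, hw₂.1.ennreal_ofReal, hw₁.ofReal_ne, hq1, hq1, le_top, by simp,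
        hA₁.smoothingBounded hq hw₁, hA₂.smoothingBounded hw₂, hmul⟩ hμ
    exact ⟨C, fun F G hFG T u _ hu => hC F G hFG T u hu⟩
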